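/- **Theorem (Non-uniqueness of Leray–Hopf solutions on $\mathbb H^2(-a^2)$).** Let $a>0$ and let $\mathbb H^2(-a^2)$ be the hyperbolic plane of constant curvature $-a^2$. Consider the Navier–Stokes equation for time-dependent 1-forms $U$ on $\mathbb H^2(-a^2)$, $$\partial_t U-\Delta U+\overline\nabla_{U}U-2\,\mathrm{Ric}(U)+dP=0,\qquad d^*U=0,$$ where $-\Delta=dd^*+d^*d$ is the Hodge Laplacian, $\mathrm{Ric}$ is the Ricci operator on 1-forms and $\overline\nabla_U$ is covariant differentiation along the vector field dual to $U$. Write $\mathrm{Def}\,U$ for the symmetric part of $\overline\nabla U$; on divergence free 1-forms $-\Delta-2\,\mathrm{Ric}=2\,\mathrm{Def}^*\mathrm{Def}$. A *Leray–Hopf weak solution* with divergence free initial datum $u_0\in L^2$ is a divergence free $U\in L^\infty(0,\infty;L^2)\cap L^2(0,\infty;H^1)$ such that * for every divergence free 1-form $\varphi\in C_c^\infty((0,\infty)\times\mathbb H^2(-a^2))$, $$\int_0^\infty\!\!\int -\langle U,\partial_t\varphi\rangle+2\langle \mathrm{Def}\,U,\mathrm{Def}\,\varphi\rangle-\langle U,\overline\nabla_U\varphi\rangle\,dV\,dt=0;$$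 * $\displaystyle\int|U(t)|^2dV+2\int_0^t\!\!\int|\mathrm{Def}\,U(s)|^2dV\,ds\le\int|u_0|^2dV$ for every $t\ge0$; * $\|U(t)-u_0\|_{L^2}\to0$ as $t\to0^+$. Then Leray–Hopf weak solutions are not unique: there are an initial datum $u_0$ and two different Leray–Hopf weak solutions with this same datum. More precisely, nonconstant bounded harmonic functions $F$ on $\mathbb H^2(-a^2)$ which extend continuously to the circle at infinity with boundary values of class $C^1$ exist. For every such $F$ and every $A\ge 2a^2$, put $\psi(t)=e^{-At/2}$ and $$U=\psi(t)\,dF,\qquad P=-\psi'(t)F-\tfrac12\psi(t)^2|dF|^2-2a^2\psi(t)F .$$ Then $(U,P)$ is smooth on $[0,\infty)\times\mathbb H^2(-a^2)$ and satisfies the Navier–Stokes equation there, and $U$ is a Leray–Hopf weak solution with initial datum $dF$. For different values of $A$ these solutions differ at every time $t>0$. -/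

import Mathlib

open MeasureTheory Set Filter Topology
open scoped ContDiff ENNReal

noncomputable section

namespace HypNS

/-! # Riemannian geometry of a surface covered by one coordinate chart

The chart is an open subset of `ℂ`, with real coordinates `x⁰ = re z`, `x¹ = im z`.
Tensor fields are given by their components in these coordinates; indices run over `Fin 2`. -/

/-- Components `α_j` of a 1-form. -/
abbrev OneForm := ℂ → Fin 2 → ℝ

/-- Components `S_{jk}` of a covariant 2-tensor. -/
abbrev TwoTensor := ℂ → Fin 2 → Fin 2 → ℝ

/-- Components `g_{jk}` of a Riemannian metric. -/
abbrev MetricField := ℂ → Matrix (Fin 2) (Fin 2) ℝ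

/-- The coordinate vectors `∂₀ = 1`, `∂₁ = i`. -/
def coordVec : Fin 2 → ℂ := ![1, Complex.I]

/-- The partial derivative `∂_i f`. -/
def pd (i : Fin 2) (f : ℂ → ℝ) (x : ℂ) : ℝ := fderiv ℝ f x (coordVec i)

/-- The differential `df` of a function. -/
def dFun (f : ℂ → ℝ) : OneForm := fun x i => pd i f x

/-- The Riemannian volume density `√det g`. -/
def volDensity (g : MetricField) (x : ℂ) : ℝ := Real.sqrt (g x).det

/-- The Riemannian volume measure on the chart domain `D`. -/
def vol (g : MetricField) (D : Set ℂ) : Measure ℂ :=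
  (volume.restrict D).withDensity fun x => ENNReal.ofReal (volDensity g x)

/-- Christoffel symbols
`Γ^l_{jk} = ½ g^{lm} (∂_j g_{mk} + ∂_k g_{mj} - ∂_m g_{jk})` of the Levi-Civita connection. -/
def christoffel (g : MetricField) (l j k : Fin 2) (x : ℂ) : ℝ :=
  (1 / 2) * ∑ m, (g x)⁻¹ l m *
    (pd j (fun y => g y m k) x + pd k (fun y => g y m j) x - pd m (fun y => g y j k) x)

/-- The vector field dual to a 1-form: `α^i = g^{ij} α_j`. -/
def sharp (g : MetricField) (α : OneForm) (x : ℂ) (i : Fin 2) : ℝ :=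
  ∑ j, (g x)⁻¹ i j * α x j

/-- The dual metric on 1-forms: `g^{ij} α_i η_j`. -/
def inner1 (g : MetricField) (α η : OneForm) (x : ℂ) : ℝ :=
  ∑ i, ∑ j, (g x)⁻¹ i j * α x i * η x j

/-- The induced inner product of covariant 2-tensors: `g^{ik} g^{jl} S_{ij} T_{kl}`. -/
def inner2 (g : MetricField) (S T : TwoTensor) (x : ℂ) : ℝ :=
  ∑ i, ∑ j, ∑ k, ∑ l, (g x)⁻¹ i k * (g x)⁻¹ j l * S x i j * T x k l

/-- The covariant derivative of a 1-form: `α_{j;k} = ∂_k α_j - Γ^l_{jk} α_l`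
(the second index is the direction of differentiation). -/
def covDeriv (g : MetricField) (α : OneForm) : TwoTensor := fun x j k =>
  pd k (fun y => α y j) x - ∑ l, christoffel g l j k x * α x l

/-- The symmetric part of a covariant 2-tensor. -/
def symPart (S : TwoTensor) : TwoTensor := fun x j k => (1 / 2) * (S x j k + S x k j)

/-- The deformation tensor `(Def α)_{jk} = ½ (α_{j;k} + α_{k;j})`. -/
def deform (g : MetricField) (α : OneForm) : TwoTensor := symPart (covDeriv g α)

/-- The covariant derivative `(∇_U η)_j = U^k η_{j;k}` of the 1-form `η` in the direction of the
vector field dual to the 1-form `U`. -/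
def covDerivAlong (g : MetricField) (U η : OneForm) : OneForm := fun x j =>
  ∑ k, sharp g U x k * covDeriv g η x j k

/-- The codifferential of a 1-form: `d*α = -(1/√det g) ∂_i (√det g α^i)`, that is, minus the
divergence of the dual vector field. -/
def codiff1 (g : MetricField) (α : OneForm) (x : ℂ) : ℝ :=
  -(∑ i, pd i (fun y => volDensity g y * sharp g α y i) x) / volDensity g x

/-- The exterior derivative of a 1-form: `(dα)_{ij} = ∂_i α_j - ∂_j α_i`. -/
def extDeriv1 (α : OneForm) : TwoTensor := fun x i j =>
  pd i (fun y => α y j) x - pd j (fun y => α y i) x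

/-- Raising both indices: `β^{ij} = g^{ik} g^{jl} β_{kl}`. -/
def raise2 (g : MetricField) (β : TwoTensor) : TwoTensor := fun x i j =>
  ∑ k, ∑ l, (g x)⁻¹ i k * (g x)⁻¹ j l * β x k l

/-- The codifferential of a 2-form (an antisymmetric `β`):
`(d*β)_i = g_{ij} (d*β)^j` with `(d*β)^j = -(1/√det g) ∂_k (√det g β^{kj})`. -/
def codiff2 (g : MetricField) (β : TwoTensor) : OneForm := fun x i =>
  ∑ j, g x i j *
    (-(∑ k, pd k (fun y => volDensity g y * raise2 g β y k j) x) / volDensity g x)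

/-- The Hodge Laplacian on 1-forms, with the sign convention `-Δ = d d* + d* d`. -/
def hodgeLaplacian (g : MetricField) (α : OneForm) : OneForm := fun x i =>
  -(dFun (codiff1 g α) x i + codiff2 g (extDeriv1 α) x i)

/-- The Laplace–Beltrami operator on functions, `-Δf = d* d f`. -/
def laplaceBeltrami (g : MetricField) (f : ℂ → ℝ) (x : ℂ) : ℝ := -codiff1 g (dFun f) x

/-- The Ricci tensor `Ric_{jk} = ∂_i Γ^i_{jk} - ∂_j Γ^i_{ik} + Γ^i_{im} Γ^m_{jk} - Γ^i_{jm} Γ^m_{ik}`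
(positive on round spheres). -/
def ricci (g : MetricField) : TwoTensor := fun x j k =>
  ∑ i, (pd i (christoffel g i j k) x - pd j (christoffel g i i k) x
    + ∑ m, (christoffel g i i m x * christoffel g m j k x
      - christoffel g i j m x * christoffel g m i k x))

/-- The Ricci operator on 1-forms, `Ric(α)_j = Ric_{jk} α^k`. -/
def ricciOp (g : MetricField) (α : OneForm) : OneForm := fun x j =>
  ∑ k, ricci g x j k * sharp g α x k

/-! # `L²` norms, test objects, weak derivatives -/

/-- The squared `L²` norm of a 1-form on `D`. -/
def l2sq1 (g : MetricField) (D : Set ℂ) (α : OneForm) : ℝ≥0∞ :=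
  ∫⁻ x, ENNReal.ofReal (inner1 g α α x) ∂(vol g D)

/-- The squared `L²` norm of a covariant 2-tensor on `D`. -/
def l2sq2 (g : MetricField) (D : Set ℂ) (S : TwoTensor) : ℝ≥0∞ :=
  ∫⁻ x, ENNReal.ofReal (inner2 g S S x) ∂(vol g D)

/-- `η ∈ C_c^∞(D)`. -/
def IsTestFunction (D : Set ℂ) (η : ℂ → ℝ) : Prop :=
  ContDiff ℝ ∞ η ∧ HasCompactSupport η ∧ tsupport η ⊆ D

/-- `T` is the covariant derivative of the 1-form `α` on `D` in the sense of distributions: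
the weak partial derivative `∂_k α_j` is `T_{jk} + Γ^l_{jk} α_l`. -/
def IsWeakCovDeriv (g : MetricField) (D : Set ℂ) (α : OneForm) (T : TwoTensor) : Prop :=
  ∀ j k : Fin 2,
    LocallyIntegrableOn (fun x => α x j) D ∧ LocallyIntegrableOn (fun x => T x j k) D ∧
    ∀ η : ℂ → ℝ, IsTestFunction D η →
      ∫ x in D, α x j * pd k η x =
        -∫ x in D, (T x j k + ∑ l, christoffel g l j k x * α x l) * η x

/-- `d*α = 0` on `D` in the sense of distributions. -/
def IsWeaklyDivFree (g : MetricField) (D : Set ℂ) (α : OneForm) : Prop :=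
  ∀ η : ℂ → ℝ, IsTestFunction D η → ∫ x, inner1 g α (dFun η) x ∂(vol g D) = 0

/-- `φ` is a divergence free 1-form of class `C_c^∞((0,∞) × D)`. -/
def IsDivFreeTestForm (g : MetricField) (D : Set ℂ) (φ : ℝ → OneForm) : Prop :=
  ContDiff ℝ ∞ (fun p : ℝ × ℂ => φ p.1 p.2) ∧
  HasCompactSupport (fun p : ℝ × ℂ => φ p.1 p.2) ∧
  tsupport (fun p : ℝ × ℂ => φ p.1 p.2) ⊆ Ioi 0 ×ˢ D ∧
  ∀ t, ∀ x ∈ D, codiff1 g (φ t) x = 0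

/-- The time derivative of a time-dependent 1-form. -/
def timeDeriv (U : ℝ → OneForm) (t : ℝ) : OneForm := fun x j => deriv (fun s => U s x j) t

/-! # The Navier–Stokes equation -/

/-- `(U, P)` is smooth on `[0,∞) × D` and solves the Navier–Stokes equation
`∂_t U - ΔU + ∇_U U - 2 Ric(U) + dP = 0`, `d*U = 0` there. -/
structure IsSmoothSolution (g : MetricField) (D : Set ℂ) (U : ℝ → OneForm) (P : ℝ → ℂ → ℝ) :
    Prop where
  smooth_velocity : ContDiffOn ℝ ∞ (fun p : ℝ × ℂ => U p.1 p.2) (Ici 0 ×ˢ D)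
  smooth_pressure : ContDiffOn ℝ ∞ (fun p : ℝ × ℂ => P p.1 p.2) (Ici 0 ×ˢ D)
  momentum : ∀ t > 0, ∀ x ∈ D, ∀ j,
    timeDeriv U t x j - hodgeLaplacian g (U t) x j + covDerivAlong g (U t) (U t) x j
      - 2 * ricciOp g (U t) x j + dFun (P t) x j = 0
  divFree : ∀ t ≥ 0, ∀ x ∈ D, codiff1 g (U t) x = 0

/-- `U` is a Leray–Hopf weak solution with initial datum `u₀`, and `T t` is the weak covariant
derivative of `U t`. The dissipative operator is `2 Def* Def`, which equals `-Δ - 2 Ric` on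
divergence free 1-forms. -/
structure IsLerayHopfWith (g : MetricField) (D : Set ℂ) (u₀ : OneForm) (U : ℝ → OneForm)
    (T : ℝ → TwoTensor) : Prop where
  datum_measurable : AEStronglyMeasurable u₀ (vol g D)
  datum_l2 : l2sq1 g D u₀ < ⊤
  datum_divFree : IsWeaklyDivFree g D u₀
  measurable_slice : ∀ t ≥ 0, AEStronglyMeasurable (U t) (vol g D)
  measurable_velocity : AEStronglyMeasurable (fun p : ℝ × ℂ => U p.1 p.2)
    ((volume.restrict (Ioi 0)).prod (vol g D))
  measurable_gradient : AEStronglyMeasurable (fun p : ℝ × ℂ => T p.1 p.2)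
    ((volume.restrict (Ioi 0)).prod (vol g D))
  weak_gradient : ∀ᵐ t ∂(volume.restrict (Ioi (0 : ℝ))), IsWeakCovDeriv g D (U t) (T t)
  /-- `U ∈ L^∞(0,∞; L²)` -/
  bounded_energy : ∃ C : ℝ, ∀ᵐ t ∂(volume.restrict (Ioi (0 : ℝ))),
    l2sq1 g D (U t) ≤ ENNReal.ofReal C
  /-- `U ∈ L²(0,∞; H¹)` -/
  finite_dissipation : ∫⁻ t in Ioi (0 : ℝ), (l2sq1 g D (U t) + l2sq2 g D (T t)) < ⊤
  divFree : ∀ᵐ t ∂(volume.restrict (Ioi (0 : ℝ))), IsWeaklyDivFree g D (U t)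
  /-- the weak form of the equation, against divergence free test forms -/
  momentum : ∀ φ : ℝ → OneForm, IsDivFreeTestForm g D φ →
    ∫ t in Ioi (0 : ℝ), ∫ x, (-inner1 g (U t) (timeDeriv φ t) x
      + 2 * inner2 g (symPart (T t)) (deform g (φ t)) x
      - inner1 g (U t) (covDerivAlong g (U t) (φ t)) x) ∂(vol g D) = 0
  /-- the global energy inequality; `symPart (T s)` is `Def (U s)` -/
  energy : ∀ t ≥ 0,
    l2sq1 g D (U t) + 2 * ∫⁻ s in Ioc 0 t, l2sq2 g D (symPart (T s)) ≤ l2sq1 g D u₀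
  initial : Tendsto (fun t => l2sq1 g D (fun x j => U t x j - u₀ x j)) (𝓝[>] 0) (𝓝 0)

/-- `U` is a Leray–Hopf weak solution of the Navier–Stokes equation on `(D, g)` with initial
datum `u₀`. -/
def IsLerayHopf (g : MetricField) (D : Set ℂ) (u₀ : OneForm) (U : ℝ → OneForm) : Prop :=
  ∃ T : ℝ → TwoTensor, IsLerayHopfWith g D u₀ U T

/-! # The hyperbolic plane of curvature `-a²` -/

/-- The open unit disc. -/
def disc : Set ℂ := Metric.ball 0 1

/-- The Poincaré disc metric `4 |dz|² / (a² (1 - |z|²)²)` of constant curvature `-a²`. -/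
def hypMetric (a : ℝ) : MetricField := fun x =>
  (4 / (a ^ 2 * (1 - Complex.normSq x) ^ 2)) • (1 : Matrix (Fin 2) (Fin 2) ℝ)

/-- `F` is a harmonic function on the hyperbolic plane, smooth there and continuous up to the
circle at infinity (hence bounded), with boundary values of class `C¹`. -/
structure IsHarmonicC1 (a : ℝ) (F : ℂ → ℝ) : Prop where
  smooth : ContDiffOn ℝ ∞ F disc
  harmonic : ∀ x ∈ disc, laplaceBeltrami (hypMetric a) F x = 0
  continuous : ContinuousOn F (Metric.closedBall 0 1)
  boundary : ContDiff ℝ 1 fun θ : ℝ => F (Complex.exp (θ * Complex.I))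

/-- `ψ(t) = e^{-At/2}`. -/
def psi (A t : ℝ) : ℝ := Real.exp (-(A * t) / 2)

/-- The velocity `U = ψ(t) dF`. -/
def velocity (A : ℝ) (F : ℂ → ℝ) (t : ℝ) : OneForm := fun x j => psi A t * dFun F x j

/-- The pressure `P = -ψ'(t) F - ½ ψ(t)² |dF|² - 2 a² ψ(t) F`. -/
def pressure (a A : ℝ) (F : ℂ → ℝ) (t : ℝ) (x : ℂ) : ℝ :=
  -deriv (psi A) t * F x - (1 / 2) * psi A t ^ 2 * inner1 (hypMetric a) (dFun F) (dFun F) x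
    - 2 * a ^ 2 * psi A t * F x

end HypNS

end

/-! If `F` is harmonic, `dF` is closed and coclosed, so the Hodge Laplacian annihilates `U = ψ(t)
dF`. The curvature is constant, so `-2 Ric(U) = 2a² U`, and `∇_U U = ½ d|U|²` because `U` is closed.
Every term of the equation is thus the differential of a function, and the pressure absorbs the sum
whatever `ψ` is: the equation does not determine `ψ`. In the weak form the same fact reads that
divergence free test forms are orthogonal to differentials.

What restricts `ψ` is the function space and the energy inequality. The `L²` norm of a 1-form is
conformally invariant in dimension two, so `∫ |dF|²` is the Euclidean Dirichlet integral on the unit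
disc. Write `F = Re h` with `h = Σ cₙ zⁿ`. For `n ≥ 1` the `n`-th Fourier coefficient of the
boundary values is `cₙ / 2`, so `C¹` boundary values make `Σ n² |cₙ|²` finite
(`summable_sq_taylorCoeff`), and with it the Dirichlet integral `π Σ n |cₙ|²`.

The integrated Bochner identity `∫ |∇dF|² = a² ∫ |dF|²` (`l2sq2_covDeriv`) follows by comparing
power series. With `f = h'` the Hessian of `F` is encoded by `(1 - |z|²) f' - 2 z̄ f`, and Parseval
on circles followed by a radial integral gives `∫ |(1 - |z|²) f' - 2 z̄ f|² = 2 ∫ |f|²`, coefficient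
by coefficient. No cut-off at infinity is needed.

Since `Def dF = ∇dF`, the energy inequality becomes `ψ(t)² + 2a² ∫₀ᵗ ψ² ≤ 1`. For `ψ² = e^{-At}` the
integral is `(1 - ψ(t)²) / A`, so `A ≥ 2a²` suffices, and distinct rates give distinct solutions
with the same datum `dF`. -/

namespace HypNS

/-! ### Absolutely convergent one-sided Fourier series on the circle. -/

open Real in
/-- Orthogonality of the characters of the circle. -/
lemma integral_exp_int_mul_I (k : ℤ) :
    ∫ θ in (-π)..π, Complex.exp (k * θ * Complex.I) = if k = 0 then 2 * (π : ℂ) else 0 := by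
  split_ifs with h
  · subst h
    simp
    ring
  · have hk : (k : ℂ) * Complex.I ≠ 0 := mul_ne_zero (by exact_mod_cast h) Complex.I_ne_zero
    have h1 : ∀ θ : ℝ, Complex.exp (k * θ * Complex.I) = Complex.exp (k * Complex.I * θ) :=
      fun θ => by ring_nf
    simp_rw [h1]
    rw [integral_exp_mul_complex hk, div_eq_zero_iff]
    left
    rw [sub_eq_zero, Complex.exp_eq_exp_iff_exists_int]
    exact ⟨k, by push_cast; ring⟩

lemma norm_exp_int_mul_I (k : ℤ) (θ : ℝ) : ‖Complex.exp (k * θ * Complex.I)‖ = 1 := by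
  have : (k : ℂ) * θ * Complex.I = ((k * θ : ℝ) : ℂ) * Complex.I := by push_cast; ring
  rw [this, Complex.norm_exp_ofReal_mul_I]

lemma norm_exp_nat_mul_I (n : ℕ) (θ : ℝ) : ‖Complex.exp (n * θ * Complex.I)‖ = 1 := by
  simpa using norm_exp_int_mul_I n θ

section Fourier

variable {d : ℕ → ℂ} {G : ℝ → ℂ}

lemma continuous_of_hasSum_exp (hd : Summable fun n => ‖d n‖)
    (hG : ∀ θ : ℝ, HasSum (fun n : ℕ => d n * Complex.exp (n * θ * Complex.I)) (G θ)) :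
    Continuous G := by
  have : G = fun θ : ℝ => ∑' n : ℕ, d n * Complex.exp (n * θ * Complex.I) :=
    funext fun θ => (hG θ).tsum_eq.symm
  rw [this]
  refine continuous_tsum (fun n => by fun_prop) hd fun n θ => ?_
  rw [norm_mul, norm_exp_nat_mul_I, mul_one]

open Real in
/-- Termwise integration of an absolutely convergent trigonometric series. -/
lemma hasSum_integral_mul (hd : Summable fun n => ‖d n‖)
    (hG : ∀ θ : ℝ, HasSum (fun n : ℕ => d n * Complex.exp (n * θ * Complex.I)) (G θ))
    {g : ℝ → ℂ} (hg : Continuous g) :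
    HasSum (fun n : ℕ => d n * ∫ θ in (-π)..π, Complex.exp (n * θ * Complex.I) * g θ)
      (∫ θ in (-π)..π, G θ * g θ) := by
  have := intervalIntegral.hasSum_integral_of_dominated_convergence (μ := volume)
    (a := -π) (b := π) (f := fun θ => G θ * g θ)
    (F := fun (n : ℕ) θ => d n * Complex.exp (n * θ * Complex.I) * g θ)
    (fun n θ => ‖d n‖ * ‖g θ‖) (fun n => by fun_prop)
    (fun n => ae_of_all _ fun θ _ => by
      rw [norm_mul, norm_mul, norm_exp_nat_mul_I, mul_one])
    (ae_of_all _ fun θ _ => hd.mul_right _)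
    (by
      simp_rw [tsum_mul_right]
      exact Continuous.intervalIntegrable (by fun_prop) _ _)
    (ae_of_all _ fun θ _ => (hG θ).mul_right _)
  simpa only [mul_assoc, intervalIntegral.integral_const_mul] using this

open Real in
-- The integer `k` may have either sign: `k = m` extracts a coefficient, while `k = -m` with `m ≠ 0`
-- gives zero because the series has no negative frequencies.
lemma integral_mul_exp_neg (hd : Summable fun n => ‖d n‖)
    (hG : ∀ θ : ℝ, HasSum (fun n : ℕ => d n * Complex.exp (n * θ * Complex.I)) (G θ)) (k : ℤ) :
    HasSum (fun n : ℕ => if (n : ℤ) = k then 2 * π * d n else 0)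
      (∫ θ in (-π)..π, G θ * Complex.exp (((-k : ℤ) : ℂ) * θ * Complex.I)) := by
  convert hasSum_integral_mul hd hG
    (g := fun θ => Complex.exp (((-k : ℤ) : ℂ) * θ * Complex.I)) (by fun_prop) using 2 with n
  have h1 : ∀ θ : ℝ, Complex.exp (n * θ * Complex.I) *
      Complex.exp (((-k : ℤ) : ℂ) * θ * Complex.I)
      = Complex.exp (((n - k : ℤ) : ℂ) * θ * Complex.I) := by
    intro θ
    rw [← Complex.exp_add]
    congr 1
    push_cast
    ring
  simp_rw [h1]
  rw [integral_exp_int_mul_I]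
  simp only [sub_eq_zero]
  split_ifs <;> ring

open Real in
lemma integral_mul_exp_neg_nat (hd : Summable fun n => ‖d n‖)
    (hG : ∀ θ : ℝ, HasSum (fun n : ℕ => d n * Complex.exp (n * θ * Complex.I)) (G θ)) (m : ℕ) :
    ∫ θ in (-π)..π, G θ * Complex.exp (-m * θ * Complex.I) = 2 * π * d m := by
  have h := integral_mul_exp_neg hd hG m
  simp only [Nat.cast_inj] at h
  have h2 := h.unique (hasSum_ite_eq m (2 * π * d m) |>.congr_fun (g := _) ?_)
  · simpa using h2
  · intro n
    split_ifs with hn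
    · rw [hn]
    · rfl

open Real in
lemma integral_mul_exp_pos_nat (hd : Summable fun n => ‖d n‖)
    (hG : ∀ θ : ℝ, HasSum (fun n : ℕ => d n * Complex.exp (n * θ * Complex.I)) (G θ)) {m : ℕ}
    (hm : m ≠ 0) :
    ∫ θ in (-π)..π, G θ * Complex.exp (m * θ * Complex.I) = 0 := by
  have h := integral_mul_exp_neg hd hG (-m)
  have h0 : (fun n : ℕ => if (n : ℤ) = -m then 2 * π * d n else 0) = fun _ => 0 := by
    funext n
    rw [if_neg (by omega)]
  rw [h0] at h
  simpa using h.unique hasSum_zero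

open Real in
/-- Parseval's identity for absolutely convergent one-sided trigonometric series. -/
lemma hasSum_integral_norm_sq (hd : Summable fun n => ‖d n‖)
    (hG : ∀ θ : ℝ, HasSum (fun n : ℕ => d n * Complex.exp (n * θ * Complex.I)) (G θ)) :
    HasSum (fun n : ℕ => 2 * π * ‖d n‖ ^ 2) (∫ θ in (-π)..π, ‖G θ‖ ^ 2) := by
  have hc := continuous_of_hasSum_exp hd hG
  -- Integrating `G · conj G` termwise leaves the conjugate of the `n`-th Fourier integral of `G` in
  -- the `n`-th term.
  have h := hasSum_integral_mul hd hG (g := fun θ => (starRingEnd ℂ) (G θ)) (by fun_prop)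
  have h1 : ∀ n : ℕ, ∫ θ in (-π)..π, Complex.exp (n * θ * Complex.I) * (starRingEnd ℂ) (G θ)
      = 2 * π * (starRingEnd ℂ) (d n) := by
    intro n
    have h2 : ∀ θ : ℝ, Complex.exp (n * θ * Complex.I) * (starRingEnd ℂ) (G θ)
        = (starRingEnd ℂ) (G θ * Complex.exp (-n * θ * Complex.I)) := by
      intro θ
      rw [map_mul, ← Complex.exp_conj]
      simp [mul_comm]
    simp_rw [h2]
    rw [intervalIntegral.intervalIntegral_conj, integral_mul_exp_neg_nat hd hG]
    simp only [map_mul, map_ofNat, Complex.conj_ofReal]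
  simp_rw [h1, Complex.mul_conj, Complex.normSq_eq_norm_sq] at h
  rw [intervalIntegral.integral_ofReal] at h
  have h3 : (fun n : ℕ => d n * (2 * π * (starRingEnd ℂ) (d n)))
      = fun n : ℕ => ((2 * π * ‖d n‖ ^ 2 : ℝ) : ℂ) := by
    funext n
    rw [mul_left_comm, Complex.mul_conj, Complex.normSq_eq_norm_sq]
    push_cast
    ring
  rw [h3] at h
  exact_mod_cast h

open Real in
-- Parseval in `ℝ≥0∞`: the sum over frequencies can then be exchanged with the radial integral by
-- Tonelli, and the resulting disc identities hold even when both sides are infinite.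
lemma lintegral_norm_sq (hd : Summable fun n => ‖d n‖)
    (hG : ∀ θ : ℝ, HasSum (fun n : ℕ => d n * Complex.exp (n * θ * Complex.I)) (G θ)) :
    ∫⁻ θ in Ioo (-π) π, ENNReal.ofReal (‖G θ‖ ^ 2)
      = ∑' n : ℕ, ENNReal.ofReal (2 * π * ‖d n‖ ^ 2) := by
  have hc := continuous_of_hasSum_exp hd hG
  have h := hasSum_integral_norm_sq hd hG
  rw [← ENNReal.ofReal_tsum_of_nonneg (fun n => by positivity) h.summable, h.tsum_eq,
    intervalIntegral.integral_of_le (by linarith [pi_pos]), restrict_Ioo_eq_restrict_Ioc,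
    ofReal_integral_eq_lintegral_ofReal _ (ae_of_all _ fun θ => by positivity)]
  exact ((by fun_prop : Continuous fun θ => ‖G θ‖ ^ 2).intervalIntegrable _ _).1

end Fourier

/-! ### Square norms of power series on the disc, through polar coordinates. -/

open Real in
/-- Integration over the unit disc in polar coordinates. -/
lemma lintegral_disc_polar {f : ℂ → ℝ≥0∞} (hf : ContinuousOn f disc) :
    ∫⁻ z in disc, f z = ∫⁻ r in Ioo (0 : ℝ) 1, ENNReal.ofReal r *
      ∫⁻ θ in Ioo (-π) π, f (r * Complex.exp (θ * Complex.I)) := by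
  classical
  have hmd : MeasurableSet disc := measurableSet_ball
  have hpol : ∀ p : ℝ × ℝ, Complex.polarCoord.symm p = p.1 * Complex.exp (p.2 * Complex.I) := by
    intro p
    rw [Complex.polarCoord_symm_apply, Complex.exp_mul_I]
    push_cast
    rfl
  have hfm : Measurable (disc.indicator f) := by
    rw [← piecewise_eq_indicator]
    exact hf.measurable_piecewise continuousOn_const hmd
  rw [← lintegral_indicator hmd, ← Complex.lintegral_comp_polarCoord_symm]
  have ht : polarCoord.target = Ioi (0 : ℝ) ×ˢ Ioo (-π) π := rfl
  rw [ht, Measure.volume_eq_prod, ← Measure.prod_restrict, lintegral_prod]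
  · simp only [hpol, smul_eq_mul]
    have hI : volume.restrict (Ioo (0 : ℝ) 1) = (volume.restrict (Ioi 0)).restrict (Iio 1) := by
      rw [Measure.restrict_restrict measurableSet_Iio, inter_comm, Ioi_inter_Iio]
    rw [hI, ← lintegral_indicator measurableSet_Iio]
    refine setLIntegral_congr_fun measurableSet_Ioi fun r hr => ?_
    have hr0 : (0 : ℝ) < r := hr
    have hn : ∀ θ : ℝ, ‖(r : ℂ) * Complex.exp (θ * Complex.I)‖ = r := fun θ => by
      rw [norm_mul, Complex.norm_exp_ofReal_mul_I, mul_one, Complex.norm_real,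
        Real.norm_of_nonneg hr0.le]
    have hm : ∀ θ : ℝ, (r : ℂ) * Complex.exp (θ * Complex.I) ∈ disc ↔ r < 1 := fun θ => by
      rw [disc, mem_ball_zero_iff, hn]
    by_cases h1 : r < 1
    · rw [indicator_of_mem (show r ∈ Iio 1 from h1), lintegral_const_mul']
      · congr 1
        refine lintegral_congr fun θ => ?_
        rw [indicator_of_mem ((hm θ).2 h1)]
      · exact ENNReal.ofReal_ne_top
    · rw [indicator_of_notMem (show r ∉ Iio 1 from h1)]
      simp [indicator_of_notMem, hm, h1]
  · simp only [hpol, smul_eq_mul]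
    exact ((by fun_prop : Measurable fun p : ℝ × ℝ => ENNReal.ofReal p.1).mul
      (hfm.comp (by fun_prop))).aemeasurable

/-- Absolute convergence of the Taylor series on a smaller disc. -/
lemma summable_norm_mul_pow {b : ℕ → ℂ}
    (hb : ∀ z ∈ disc, Summable fun n => b n * z ^ n) {r : ℝ} (h0 : 0 ≤ r) (h1 : r < 1) :
    Summable fun n => ‖b n‖ * r ^ n := by
  have hmem : (r : ℂ) ∈ disc := by
    rw [disc, mem_ball_zero_iff, Complex.norm_real, Real.norm_of_nonneg h0]
    exact h1
  simpa [abs_of_nonneg h0] using (hb _ hmem).norm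

/-- If on every circle of radius `r ∈ (0, 1)` the function `G`, rotated by a fixed character, has the
Fourier coefficients `d n r`, then its squared `L²` norm on the disc is the sum of the radial
integrals of the `‖d n r‖ ^ 2`. -/
lemma lintegral_disc_eq_tsum {G : ℂ → ℂ} (hG : ContinuousOn G disc) {d : ℕ → ℝ → ℂ} (k : ℕ)
    (hdm : ∀ n, Continuous (d n))
    (hd : ∀ r ∈ Ioo (0 : ℝ) 1, Summable fun n => ‖d n r‖)
    (hs : ∀ r ∈ Ioo (0 : ℝ) 1, ∀ θ : ℝ,
      HasSum (fun n : ℕ => d n r * Complex.exp (n * θ * Complex.I))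
        (Complex.exp (k * θ * Complex.I) * G (r * Complex.exp (θ * Complex.I)))) :
    ∫⁻ z in disc, ENNReal.ofReal (‖G z‖ ^ 2)
      = ∑' n : ℕ, ENNReal.ofReal (∫ r in (0 : ℝ)..1, r * (2 * Real.pi * ‖d n r‖ ^ 2)) := by
  rw [lintegral_disc_polar (f := fun z => ENNReal.ofReal (‖G z‖ ^ 2))
    (ENNReal.continuous_ofReal.comp_continuousOn (hG.norm.pow 2))]
  have h1 : ∀ r ∈ Ioo (0 : ℝ) 1, ENNReal.ofReal r * ∫⁻ θ in Ioo (-Real.pi) Real.pi,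
      ENNReal.ofReal (‖G (r * Complex.exp (θ * Complex.I))‖ ^ 2)
      = ∑' n : ℕ, ENNReal.ofReal (r * (2 * Real.pi * ‖d n r‖ ^ 2)) := by
    intro r hr
    have h2 := lintegral_norm_sq (hd r hr) (hs r hr)
    simp_rw [norm_mul, norm_exp_nat_mul_I, one_mul] at h2
    rw [h2, ← ENNReal.tsum_mul_left]
    exact tsum_congr fun n => (ENNReal.ofReal_mul hr.1.le).symm
  rw [setLIntegral_congr_fun measurableSet_Ioo h1, lintegral_tsum (fun n => by fun_prop)]
  refine tsum_congr fun n => ?_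
  rw [intervalIntegral.integral_of_le zero_le_one, restrict_Ioo_eq_restrict_Ioc,
    ofReal_integral_eq_lintegral_ofReal]
  · exact ((by fun_prop : Continuous fun r : ℝ =>
      r * (2 * Real.pi * ‖d n r‖ ^ 2)).intervalIntegrable _ _).1
  · filter_upwards [ae_restrict_mem measurableSet_Ioc] with r hr
    have := hr.1.le
    positivity

lemma mul_pow_exp (b : ℂ) (r θ : ℝ) (n : ℕ) :
    b * ((r : ℂ) * Complex.exp (θ * Complex.I)) ^ n
      = b * (r : ℂ) ^ n * Complex.exp (n * θ * Complex.I) := by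
  rw [mul_pow, ← Complex.exp_nat_mul]
  ring_nf

lemma circle_mem_disc {r : ℝ} (hr : r ∈ Ioo (0 : ℝ) 1) (θ : ℝ) :
    (r : ℂ) * Complex.exp (θ * Complex.I) ∈ disc := by
  rw [disc, mem_ball_zero_iff, norm_mul, Complex.norm_exp_ofReal_mul_I, mul_one, Complex.norm_real,
    Real.norm_of_nonneg hr.1.le]
  exact hr.2

/-- The Bergman norm of a power series. -/
lemma lintegral_disc_norm_sq {f : ℂ → ℂ} {b : ℕ → ℂ} (hf : ContinuousOn f disc)
    (hb : ∀ z ∈ disc, HasSum (fun n => b n * z ^ n) (f z)) :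
    ∫⁻ z in disc, ENNReal.ofReal (‖f z‖ ^ 2)
      = ∑' n : ℕ, ENNReal.ofReal (Real.pi * ‖b n‖ ^ 2 / (n + 1)) := by
  rw [lintegral_disc_eq_tsum hf 0 (d := fun n r => b n * (r : ℂ) ^ n) (fun n => by fun_prop)]
  · refine tsum_congr fun n => ?_
    congr 1
    have h1 : ∀ r : ℝ, r * (2 * Real.pi * ‖b n * (r : ℂ) ^ n‖ ^ 2)
        = 2 * Real.pi * ‖b n‖ ^ 2 * r ^ (2 * n + 1) := by
      intro r
      rw [norm_mul, norm_pow, Complex.norm_real, mul_pow, ← pow_mul, mul_comm n 2,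
        pow_mul ‖r‖, Real.norm_eq_abs, sq_abs]
      ring
    simp_rw [h1]
    rw [intervalIntegral.integral_const_mul, integral_pow]
    have : ((n : ℝ) + 1) ≠ 0 := by positivity
    push_cast
    field_simp
    simp
    ring
  · intro r hr
    simpa [abs_of_pos hr.1] using
      summable_norm_mul_pow (fun z hz => (hb z hz).summable) hr.1.le hr.2
  · intro r hr θ
    simpa [mul_pow_exp] using hb _ (circle_mem_disc hr θ)

/-- For `n ≥ 1` the integrand is `r (n r^(n-1) - (n+2) r^(n+1))²`, with integral `n/2 - n(n+2)/(n+1)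
+ (n+2)/2 = 1/(n+1)`. For `n = 0` the truncated exponent `n - 1` is harmless because of the factor
`n`, and the integrand is `4 r³`. -/
lemma integral_radial_moment (n : ℕ) :
    ∫ r in (0 : ℝ)..1, r * ((1 - r ^ 2) * (n * r ^ (n - 1)) - 2 * r ^ (n + 1)) ^ 2
      = 1 / ((n : ℝ) + 1) := by
  rcases n with _ | m
  · have h1 : ∀ r : ℝ, r * ((1 - r ^ 2) * (((0 : ℕ) : ℝ) * r ^ (0 - 1)) - 2 * r ^ (0 + 1)) ^ 2
        = 4 * r ^ 3 := fun r => by push_cast; ring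
    simp_rw [h1]
    rw [intervalIntegral.integral_const_mul, integral_pow]
    norm_num
  · have h1 : ∀ r : ℝ, r * ((1 - r ^ 2) * (((m + 1 : ℕ) : ℝ) * r ^ (m + 1 - 1))
        - 2 * r ^ (m + 1 + 1)) ^ 2
        = (m + 1) ^ 2 * r ^ (2 * m + 1) - 2 * (m + 1) * (m + 3) * r ^ (2 * m + 3)
          + (m + 3) ^ 2 * r ^ (2 * m + 5) := fun r => by
      rw [Nat.add_sub_cancel]
      push_cast
      ring
    simp_rw [h1]
    rw [intervalIntegral.integral_add
        (Continuous.intervalIntegrable (by fun_prop) _ _)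
        (Continuous.intervalIntegrable (by fun_prop) _ _),
      intervalIntegral.integral_sub
        (Continuous.intervalIntegrable (by fun_prop) _ _)
        (Continuous.intervalIntegrable (by fun_prop) _ _)]
    simp only [intervalIntegral.integral_const_mul, integral_pow]
    have e1 : (m : ℝ) + 1 ≠ 0 := by positivity
    have e2 : (m : ℝ) + 2 ≠ 0 := by positivity
    have e3 : (m : ℝ) + 3 ≠ 0 := by positivity
    have f1 : ((2 * m + 1 : ℕ) : ℝ) + 1 = 2 * (m + 1) := by push_cast; ring
    have f2 : ((2 * m + 3 : ℕ) : ℝ) + 1 = 2 * (m + 2) := by push_cast; ring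
    have f3 : ((2 * m + 5 : ℕ) : ℝ) + 1 = 2 * (m + 3) := by push_cast; ring
    have f4 : ((m + 1 : ℕ) : ℝ) + 1 = m + 2 := by push_cast; ring
    rw [f1, f2, f3, f4]
    field_simp
    simp
    ring

/-- The integrated Bochner identity for holomorphic 1-forms on the disc: the covariant derivative
of `f dz` has twice the (conformally weighted) squared norm of `f`. -/
lemma lintegral_disc_norm_sq_covDeriv {f f' : ℂ → ℂ} {b : ℕ → ℂ} (hf : ContinuousOn f disc)
    (hf' : ContinuousOn f' disc) (hb : ∀ z ∈ disc, HasSum (fun n => b n * z ^ n) (f z))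
    (hb' : ∀ z ∈ disc, HasSum (fun n : ℕ => n * b n * z ^ (n - 1)) (f' z)) :
    ∫⁻ z in disc, ENNReal.ofReal
        (‖(1 - Complex.normSq z) * f' z - 2 * (starRingEnd ℂ) z * f z‖ ^ 2)
      = 2 * ∫⁻ z in disc, ENNReal.ofReal (‖f z‖ ^ 2) := by
  have hcont : ContinuousOn
      (fun z : ℂ => (1 - Complex.normSq z) * f' z - 2 * (starRingEnd ℂ) z * f z) disc :=
    (ContinuousOn.mul (by fun_prop) hf').sub (ContinuousOn.mul (by fun_prop) hf)
  have key : ∀ r : ℝ, ∀ n : ℕ,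
      b n * (((1 - r ^ 2) * (n * r ^ (n - 1)) - 2 * r ^ (n + 1) : ℝ) : ℂ)
        = (1 - (r : ℂ) ^ 2) * (n * b n * r ^ (n - 1)) - 2 * r * (b n * r ^ n) := fun r n => by
    push_cast
    ring
  -- The rotation by `exp (iθ)` aligns the two terms: it turns `z̄` into `r` and raises the
  -- frequency `n - 1` of `f'` to `n`, so only nonnegative frequencies occur and each involves a
  -- single `b n`.
  rw [lintegral_disc_eq_tsum hcont 1
    (d := fun n r => b n * (((1 - r ^ 2) * (n * r ^ (n - 1)) - 2 * r ^ (n + 1) : ℝ) : ℂ))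
    (fun n => by fun_prop), lintegral_disc_norm_sq hf hb, ← ENNReal.tsum_mul_left]
  · refine tsum_congr fun n => ?_
    have h1 : ∀ r : ℝ, r * (2 * Real.pi *
        ‖b n * (((1 - r ^ 2) * (n * r ^ (n - 1)) - 2 * r ^ (n + 1) : ℝ) : ℂ)‖ ^ 2)
        = 2 * Real.pi * ‖b n‖ ^ 2 *
          (r * ((1 - r ^ 2) * (n * r ^ (n - 1)) - 2 * r ^ (n + 1)) ^ 2) := fun r => by
      rw [norm_mul, Complex.norm_real, mul_pow, Real.norm_eq_abs, sq_abs]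
      ring
    simp_rw [h1]
    rw [intervalIntegral.integral_const_mul, integral_radial_moment,
      ← ENNReal.ofReal_ofNat 2, ← ENNReal.ofReal_mul zero_le_two]
    congr 1
    ring
  · intro r hr
    have hmem : (r : ℂ) ∈ disc := by
      simpa using circle_mem_disc hr 0
    have s1 := (((hb' _ hmem).summable.norm.mul_left ‖1 - (r : ℂ) ^ 2‖).add
      ((hb _ hmem).summable.norm.mul_left ‖2 * (r : ℂ)‖))
    refine s1.of_nonneg_of_le (fun n => norm_nonneg _) fun n => ?_
    rw [key]
    refine (norm_sub_le _ _).trans_eq ?_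
    rw [norm_mul, norm_mul (2 * (r : ℂ))]
  · intro r hr θ
    have hz := circle_mem_disc hr θ
    have e : Complex.exp ((1 : ℕ) * θ * Complex.I) = Complex.exp (θ * Complex.I) := by simp
    have hns : ((Complex.normSq (r * Complex.exp (θ * Complex.I)) : ℝ) : ℂ) = (r : ℂ) ^ 2 := by
      rw [Complex.normSq_eq_norm_sq, norm_mul, Complex.norm_exp_ofReal_mul_I, mul_one,
        Complex.norm_real, Real.norm_eq_abs, sq_abs]
      push_cast
      rfl
    have hcj : Complex.exp (θ * Complex.I)
        * (starRingEnd ℂ) ((r : ℂ) * Complex.exp (θ * Complex.I)) = r := by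
      rw [map_mul, mul_left_comm, Complex.mul_conj, Complex.normSq_eq_norm_sq,
        Complex.norm_exp_ofReal_mul_I, Complex.conj_ofReal]
      simp
    have s := ((hb' _ hz).mul_left ((1 - (r : ℂ) ^ 2) * Complex.exp (θ * Complex.I))).sub
      ((hb _ hz).mul_left (2 * (r : ℂ)))
    have hval : Complex.exp ((1 : ℕ) * θ * Complex.I) *
        ((1 - (Complex.normSq (r * Complex.exp (θ * Complex.I)) : ℝ)) *
          f' (r * Complex.exp (θ * Complex.I)) -
        2 * (starRingEnd ℂ) (r * Complex.exp (θ * Complex.I)) * f (r * Complex.exp (θ * Complex.I)))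
        = (1 - (r : ℂ) ^ 2) * Complex.exp (θ * Complex.I) * f' (r * Complex.exp (θ * Complex.I))
          - 2 * r * f (r * Complex.exp (θ * Complex.I)) := by
      rw [e, hns]
      linear_combination (-2 * f (r * Complex.exp (θ * Complex.I))) * hcj
    rw [hval]
    refine s.congr_fun fun n => ?_
    rw [key, mul_pow_exp]
    rcases n with _ | n
    · simp
    · have : Complex.exp ((n + 1 : ℕ) * θ * Complex.I)
          = Complex.exp (θ * Complex.I) * Complex.exp (n * θ * Complex.I) := by
        rw [← Complex.exp_add]
        congr 1
        push_cast
        ring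
      rw [Nat.add_sub_cancel, mul_pow_exp, this]
      ring

/-! ### Taylor coefficients, boundary Fourier coefficients and the Dirichlet integral. -/

/-- The Taylor coefficients at the origin. -/
noncomputable def taylorCoeff (h : ℂ → ℂ) (n : ℕ) : ℂ := (n.factorial : ℂ)⁻¹ * iteratedDeriv n h 0

lemma hasSum_taylorCoeff {h : ℂ → ℂ} (hh : DifferentiableOn ℂ h disc) {z : ℂ} (hz : z ∈ disc) :
    HasSum (fun n => taylorCoeff h n * z ^ n) (h z) := by
  refine (Complex.hasSum_taylorSeries_on_ball hh hz).congr_fun fun n => ?_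
  simp only [taylorCoeff, sub_zero, smul_eq_mul]
  ring

lemma taylorCoeff_deriv (h : ℂ → ℂ) (n : ℕ) :
    taylorCoeff (deriv h) n = (n + 1) * taylorCoeff h (n + 1) := by
  have : ((n : ℂ) + 1) ≠ 0 := by exact_mod_cast n.succ_ne_zero
  rw [taylorCoeff, taylorCoeff, iteratedDeriv_succ', Nat.factorial_succ]
  push_cast
  field_simp

lemma hasSum_taylorCoeff_deriv {h : ℂ → ℂ} (hh : DifferentiableOn ℂ h disc) {z : ℂ}
    (hz : z ∈ disc) : HasSum (fun n : ℕ => n * taylorCoeff h n * z ^ (n - 1)) (deriv h z) := by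
  -- The term `n = 0` vanishes, so the series may be shifted by one.
  rw [← hasSum_nat_add_iff' 1]
  simp only [Finset.range_one, Finset.sum_singleton, Nat.cast_zero, zero_mul, sub_zero]
  refine (hasSum_taylorCoeff (hh.deriv Metric.isOpen_ball) hz).congr_fun fun n => ?_
  rw [taylorCoeff_deriv, Nat.add_sub_cancel]
  push_cast
  ring

section Boundary

variable {F : ℂ → ℝ} {h : ℂ → ℂ}

open Real in
-- On the circle `F = (h + conj h) / 2`. For `n ≠ 0` the conjugate half has no frequency `n`, which
-- leaves half of `2π` times the coefficient of `h`.
lemma integral_circle_re_mul_exp (hh : DifferentiableOn ℂ h disc)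
    (hF : ∀ z ∈ disc, (h z).re = F z) {r : ℝ} (hr : r ∈ Ioo (0 : ℝ) 1) {n : ℕ} (hn : n ≠ 0) :
    ∫ θ in (-π)..π, (F (r * Complex.exp (θ * Complex.I)) : ℂ) * Complex.exp (-n * θ * Complex.I)
      = π * (taylorCoeff h n * r ^ n) := by
  set d : ℕ → ℂ := fun n => taylorCoeff h n * (r : ℂ) ^ n with hdef
  set G : ℝ → ℂ := fun θ => h (r * Complex.exp (θ * Complex.I)) with hGdef
  have hd : Summable fun n => ‖d n‖ := by
    simpa [hdef, abs_of_pos hr.1] using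
      summable_norm_mul_pow (fun z hz => (hasSum_taylorCoeff hh hz).summable) hr.1.le hr.2
  have hG : ∀ θ : ℝ, HasSum (fun n : ℕ => d n * Complex.exp (n * θ * Complex.I)) (G θ) := fun θ => by
    simpa only [mul_pow_exp] using hasSum_taylorCoeff hh (circle_mem_disc hr θ)
  have hc := continuous_of_hasSum_exp hd hG
  have h1 : ∀ θ : ℝ, (F (r * Complex.exp (θ * Complex.I)) : ℂ) * Complex.exp (-n * θ * Complex.I)
      = 1 / 2 * (G θ * Complex.exp (-n * θ * Complex.I))
        + 1 / 2 * (starRingEnd ℂ) (G θ * Complex.exp (n * θ * Complex.I)) := by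
    intro θ
    have h2 : (F (r * Complex.exp (θ * Complex.I)) : ℂ) = (G θ + (starRingEnd ℂ) (G θ)) / 2 := by
      rw [Complex.add_conj, hGdef, ← hF _ (circle_mem_disc hr θ)]
      push_cast
      ring
    have h3 : (starRingEnd ℂ) (Complex.exp (n * θ * Complex.I))
        = Complex.exp (-n * θ * Complex.I) := by
      rw [← Complex.exp_conj]
      simp
    rw [h2, map_mul, h3]
    ring
  simp_rw [h1]
  rw [intervalIntegral.integral_add
      (Continuous.intervalIntegrable (by fun_prop) _ _)
      (Continuous.intervalIntegrable (by fun_prop) _ _),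
    intervalIntegral.integral_const_mul, intervalIntegral.integral_const_mul,
    intervalIntegral.intervalIntegral_conj, integral_mul_exp_neg_nat hd hG,
    integral_mul_exp_pos_nat hd hG hn]
  simp only [hdef, map_zero, mul_zero, add_zero]
  ring

open Real in
/-- The Taylor coefficients of a holomorphic function are the Fourier coefficients of the
continuous boundary values of its real part. -/
lemma integral_boundary_mul_exp (hh : DifferentiableOn ℂ h disc)
    (hF : ∀ z ∈ disc, (h z).re = F z) (hFc : ContinuousOn F (Metric.closedBall 0 1))
    {n : ℕ} (hn : n ≠ 0) :
    ∫ θ in (-π)..π, (F (Complex.exp (θ * Complex.I)) : ℂ) * Complex.exp (-n * θ * Complex.I)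
      = π * taylorCoeff h n := by
  obtain ⟨M, hM⟩ := (isCompact_closedBall (0 : ℂ) 1).exists_bound_of_continuousOn hFc
  have hmem : ∀ r ∈ Icc (0 : ℝ) 1, ∀ θ : ℝ,
      (r : ℂ) * Complex.exp (θ * Complex.I) ∈ Metric.closedBall (0 : ℂ) 1 := by
    intro r hr θ
    rw [mem_closedBall_zero_iff, norm_mul, Complex.norm_exp_ofReal_mul_I, mul_one,
      Complex.norm_real, Real.norm_of_nonneg hr.1]
    exact hr.2
  have hIoo : ∀ᶠ r in 𝓝[<] (1 : ℝ), r ∈ Ioo (0 : ℝ) 1 := Ioo_mem_nhdsLT zero_lt_one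
  -- Let `r → 1⁻` in the formula on circles. Continuity on the closed disc supplies both the
  -- pointwise limit and the dominating constant `M`.
  have hlim : Tendsto (fun r : ℝ => ∫ θ in (-π)..π,
      (F (r * Complex.exp (θ * Complex.I)) : ℂ) * Complex.exp (-n * θ * Complex.I)) (𝓝[<] 1)
      (𝓝 (∫ θ in (-π)..π,
        (F (Complex.exp (θ * Complex.I)) : ℂ) * Complex.exp (-n * θ * Complex.I))) := by
    refine intervalIntegral.tendsto_integral_filter_of_dominated_convergence (fun _ => M)
      ?_ ?_ intervalIntegrable_const ?_
    · filter_upwards [hIoo] with r hr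
      have : Continuous fun θ : ℝ => F (r * Complex.exp (θ * Complex.I)) :=
        hFc.comp_continuous (by fun_prop) (hmem r (Ioo_subset_Icc_self hr))
      have := Complex.continuous_ofReal.comp this
      exact (this.mul (by fun_prop :
        Continuous fun θ : ℝ => Complex.exp (-n * θ * Complex.I))).aestronglyMeasurable
    · filter_upwards [hIoo] with r hr
      refine ae_of_all _ fun θ _ => ?_
      have h3 := norm_exp_int_mul_I (-n) θ
      push_cast at h3
      rw [norm_mul, h3, mul_one, Complex.norm_real]
      exact hM _ (hmem r (Ioo_subset_Icc_self hr) θ)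
    · refine ae_of_all _ fun θ _ => ?_
      refine Tendsto.mul_const _ ((Complex.continuous_ofReal.tendsto _).comp ?_)
      have h4 := (hFc _ (hmem 1 ⟨zero_le_one, le_rfl⟩ θ)).tendsto
      simp only [Complex.ofReal_one, one_mul] at h4
      refine h4.comp (tendsto_nhdsWithin_iff.2 ⟨?_, ?_⟩)
      · have : Continuous fun r : ℝ => (r : ℂ) * Complex.exp (θ * Complex.I) := by fun_prop
        simpa using (this.tendsto 1).mono_left nhdsWithin_le_nhds
      · filter_upwards [hIoo] with r hr using hmem r (Ioo_subset_Icc_self hr) θ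
  have hlim2 : Tendsto (fun r : ℝ => (π : ℂ) * (taylorCoeff h n * (r : ℂ) ^ n)) (𝓝[<] 1)
      (𝓝 (π * taylorCoeff h n)) := by
    have : Continuous fun r : ℝ => (π : ℂ) * (taylorCoeff h n * (r : ℂ) ^ n) := by fun_prop
    simpa using (this.tendsto 1).mono_left nhdsWithin_le_nhds
  refine tendsto_nhds_unique (hlim.congr' ?_) hlim2
  filter_upwards [hIoo] with r hr using integral_circle_re_mul_exp hh hF hr hn

open Real in
/-- `C¹` boundary values have square summable derivative coefficients. -/
lemma summable_sq_taylorCoeff (hh : DifferentiableOn ℂ h disc)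
    (hF : ∀ z ∈ disc, (h z).re = F z) (hFc : ContinuousOn F (Metric.closedBall 0 1))
    (hb : ContDiff ℝ 1 fun θ : ℝ => F (Complex.exp (θ * Complex.I))) :
    Summable fun n : ℕ => (n * ‖taylorCoeff h n‖) ^ 2 := by
  set g : ℝ → ℂ := fun θ => (F (Complex.exp (θ * Complex.I)) : ℂ) with hg
  have hgC : ContDiff ℝ 1 g := Complex.ofRealCLM.contDiff.comp hb
  have hab : -π < π := by linarith [pi_pos]
  have hg'c : Continuous (deriv g) := hgC.continuous_deriv le_rfl
  have hL2 : MemLp (deriv g) 2 (volume.restrict (Ioc (-π) π)) := by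
    obtain ⟨C, hC⟩ := (isCompact_Icc (a := -π) (b := π)).exists_bound_of_continuousOn hg'c.continuousOn
    refine MemLp.of_bound hg'c.aestronglyMeasurable C ?_
    filter_upwards [ae_restrict_mem measurableSet_Ioc] with θ hθ
      using hC θ (Ioc_subset_Icc_self hθ)
  have hs := (hasSum_sq_fourierCoeffOn hab hL2).summable
  have hinj : Function.Injective (fun n : ℕ => (n : ℤ)) := Nat.cast_injective
  -- The factor `4` is `2²`: the boundary function has coefficient `cₙ / 2`, so `n |cₙ|` is twice
  -- the modulus of the `n`-th coefficient of its derivative.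
  have hs2 := (hs.comp_injective hinj).mul_left 4
  refine hs2.of_nonneg_of_le (fun n => by positivity) fun n => ?_
  rcases Nat.eq_zero_or_pos n with rfl | hn
  · exact (le_of_eq (by simp)).trans (mul_nonneg zero_le_four (sq_nonneg _))
  have hfc := fourierCoeffOn_of_hasDerivAt hab (n := (n : ℤ)) (by exact_mod_cast hn.ne')
    (fun x _ => (hgC.differentiable one_ne_zero x).hasDerivAt) (hg'c.intervalIntegrable _ _)
  -- Periodicity removes the boundary term of the integration by parts.
  have hper : g π = g (-π) := by
    simp only [hg, Complex.ofReal_neg, neg_mul, Complex.exp_neg, Complex.exp_pi_mul_I]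
    norm_num
  have hval : fourierCoeffOn hab g (n : ℤ) = taylorCoeff h n / 2 := by
    rw [fourierCoeffOn_eq_integral]
    have h1 : ∀ θ : ℝ, fourier (-(n : ℤ)) (θ : AddCircle (π - -π)) • g θ
        = (F (Complex.exp (θ * Complex.I)) : ℂ) * Complex.exp (-n * θ * Complex.I) := by
      intro θ
      rw [fourier_coe_apply, smul_eq_mul, mul_comm, hg]
      congr 2
      have : (π : ℂ) ≠ 0 := by exact_mod_cast pi_ne_zero
      push_cast
      field_simp
      ring
    simp_rw [h1]
    rw [integral_boundary_mul_exp hh hF hFc hn.ne', Complex.real_smul]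
    have : (π : ℂ) ≠ 0 := by exact_mod_cast pi_ne_zero
    push_cast
    field_simp
    ring
  rw [hval, hper, sub_self, mul_zero, zero_sub] at hfc
  have hpi : (π : ℂ) ≠ 0 := by exact_mod_cast pi_ne_zero
  have hn0 : (n : ℂ) ≠ 0 := by exact_mod_cast hn.ne'
  have hc : (n : ℂ) * taylorCoeff h n
      = -Complex.I * 2 * fourierCoeffOn hab (deriv g) (n : ℤ) := by
    have h2 : taylorCoeff h n = 2 * (taylorCoeff h n / 2) := by ring
    rw [h2, hfc]
    push_cast
    field_simp
    ring_nf
    simp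
  have hnorm : (n : ℝ) * ‖taylorCoeff h n‖ = 2 * ‖fourierCoeffOn hab (deriv g) (n : ℤ)‖ := by
    have := congrArg norm hc
    simpa using this
  rw [hnorm]
  simp only [Function.comp_apply]
  exact le_of_eq (by ring)

/-- The Dirichlet integral of a harmonic function with `C¹` boundary values is finite. -/
lemma lintegral_disc_norm_sq_deriv_lt_top (hh : DifferentiableOn ℂ h disc)
    (hF : ∀ z ∈ disc, (h z).re = F z) (hFc : ContinuousOn F (Metric.closedBall 0 1))
    (hb : ContDiff ℝ 1 fun θ : ℝ => F (Complex.exp (θ * Complex.I))) :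
    ∫⁻ z in disc, ENNReal.ofReal (‖deriv h z‖ ^ 2) < ⊤ := by
  have hd := hh.deriv Metric.isOpen_ball
  rw [lintegral_disc_norm_sq hd.continuousOn fun z hz => hasSum_taylorCoeff hd hz]
  -- The Dirichlet series `π Σ (n+1) |cₙ₊₁|²` is dominated by `π Σ (n+1)² |cₙ₊₁|²`.
  have hs := ((summable_nat_add_iff 1).2 (summable_sq_taylorCoeff hh hF hFc hb)).mul_left Real.pi
  have hs2 : Summable fun n : ℕ => Real.pi * ‖taylorCoeff (deriv h) n‖ ^ 2 / (n + 1) := by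
    refine hs.of_nonneg_of_le (fun n => by positivity) fun n => ?_
    have h1 : ‖taylorCoeff (deriv h) n‖ = (n + 1 : ℕ) * ‖taylorCoeff h (n + 1)‖ := by
      rw [taylorCoeff_deriv, norm_mul]
      congr 1
      exact_mod_cast Complex.norm_natCast (n + 1)
    rw [h1]
    exact div_le_self (by positivity) (by linarith [(Nat.cast_nonneg n : (0 : ℝ) ≤ n)])
  rw [← ENNReal.ofReal_tsum_of_nonneg (fun n => by positivity) hs2]
  exact ENNReal.ofReal_lt_top

/-- The case `f = h'`. If `S` is the hyperbolic Hessian of `Re h`, the expression inside the norm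
equals `(1 - |z|²) (S₀₀ - i S₀₁)`. -/
lemma lintegral_disc_norm_sq_deriv_covDeriv (hh : DifferentiableOn ℂ h disc) :
    ∫⁻ z in disc, ENNReal.ofReal (‖(1 - Complex.normSq z) * deriv (deriv h) z
        - 2 * (starRingEnd ℂ) z * deriv h z‖ ^ 2)
      = 2 * ∫⁻ z in disc, ENNReal.ofReal (‖deriv h z‖ ^ 2) := by
  have hd := hh.deriv Metric.isOpen_ball
  exact lintegral_disc_norm_sq_covDeriv hd.continuousOn
    (hd.deriv Metric.isOpen_ball).continuousOn (fun z hz => hasSum_taylorCoeff hd hz)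
    (fun z hz => hasSum_taylorCoeff_deriv hd hz)

end Boundary

/-! ### Calculus of partial derivatives -/

section PartialDerivatives

variable {f g : ℂ → ℝ} {x : ℂ} (i j : Fin 2)

lemma pd_add (hf : DifferentiableAt ℝ f x) (hg : DifferentiableAt ℝ g x) :
    pd i (fun y => f y + g y) x = pd i f x + pd i g x := by
  simp [pd, fderiv_fun_add hf hg]

lemma pd_sub (hf : DifferentiableAt ℝ f x) (hg : DifferentiableAt ℝ g x) :
    pd i (fun y => f y - g y) x = pd i f x - pd i g x := by
  simp [pd, fderiv_fun_sub hf hg]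

lemma pd_mul (hf : DifferentiableAt ℝ f x) (hg : DifferentiableAt ℝ g x) :
    pd i (fun y => f y * g y) x = pd i f x * g x + f x * pd i g x := by
  simp [pd, fderiv_fun_mul hf hg]
  ring

lemma pd_const_mul (c : ℝ) (hf : DifferentiableAt ℝ f x) :
    pd i (fun y => c * f y) x = c * pd i f x := by
  simp [pd, fderiv_const_mul hf]

lemma pd_const (c : ℝ) : pd i (fun _ => c) x = 0 := by
  simp [pd]

lemma pd_inv (hf : DifferentiableAt ℝ f x) (h0 : f x ≠ 0) :
    pd i (fun y => (f y)⁻¹) x = -pd i f x / f x ^ 2 := by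
  have := ((hasDerivAt_inv h0).comp_hasFDerivAt x hf.hasFDerivAt).fderiv
  simp only [Function.comp_def] at this
  simp only [pd, this]
  simp
  ring

variable {i} in
lemma pd_congr (h : f =ᶠ[𝓝 x] g) : pd i f x = pd i g x := by
  rw [pd, h.fderiv_eq, pd]

lemma isOpen_disc : IsOpen disc := Metric.isOpen_ball

variable {i} in
lemma pd_congr_disc (hx : x ∈ disc) (h : ∀ y ∈ disc, f y = g y) : pd i f x = pd i g x :=
  pd_congr (mem_of_superset (isOpen_disc.mem_nhds hx) h)

lemma contDiffOn_pd (hf : ContDiffOn ℝ ∞ f disc) : ContDiffOn ℝ ∞ (pd i f) disc :=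
  (hf.fderiv_of_isOpen isOpen_disc (by simp)).clm_apply contDiffOn_const

lemma differentiableAt_disc (hf : ContDiffOn ℝ ∞ f disc) (hx : x ∈ disc) :
    DifferentiableAt ℝ f x :=
  (hf.contDiffAt (isOpen_disc.mem_nhds hx)).differentiableAt (by simp)

lemma contDiff_pd (hf : ContDiff ℝ ∞ f) : ContDiff ℝ ∞ (pd i f) :=
  (hf.fderiv_right (by simp)).clm_apply contDiff_const

lemma pd_pd_comm_of_contDiffAt (hf : ContDiffAt ℝ ∞ f x) :
    pd i (pd j f) x = pd j (pd i f) x := by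
  have hs : IsSymmSndFDerivAt ℝ f x := hf.isSymmSndFDerivAt (by simp; exact WithTop.coe_le_coe.2 le_top)
  have hd : DifferentiableAt ℝ (fderiv ℝ f) x :=
    (hf.fderiv_right (m := ∞) (by simp)).differentiableAt (by simp)
  have h : ∀ v w : ℂ, fderiv ℝ (fun y => fderiv ℝ f y v) x w = fderiv ℝ (fderiv ℝ f) x w v := by
    intro v w
    rw [fderiv_clm_apply hd (differentiableAt_const _)]
    simp
  change fderiv ℝ (fun y => fderiv ℝ f y _) x _ = fderiv ℝ (fun y => fderiv ℝ f y _) x _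
  rw [h, h]
  exact hs _ _

lemma pd_pd_comm (hf : ContDiffOn ℝ ∞ f disc) (hx : x ∈ disc) :
    pd i (pd j f) x = pd j (pd i f) x :=
  pd_pd_comm_of_contDiffAt i j (hf.contDiffAt (isOpen_disc.mem_nhds hx))

end PartialDerivatives

/-! ### The Poincaré disc -/

/-- The real coordinates of a point. -/
noncomputable def coord (i : Fin 2) (x : ℂ) : ℝ := ![x.re, x.im] i

/-- The boundary defining function `1 - |x|²`. -/
noncomputable def bdf (x : ℂ) : ℝ := 1 - Complex.normSq x

/-- The inverse conformal factor `a² (1 - |x|²)² / 4`. -/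
noncomputable def invConf (a : ℝ) (x : ℂ) : ℝ := a ^ 2 / 4 * bdf x ^ 2

/-- The derivatives `2 xₖ / (1 - |x|²)` of the logarithm of `2 / (a (1 - |x|²))`. -/
noncomputable def logConf (k : Fin 2) (x : ℂ) : ℝ := 2 * coord k x * (bdf x)⁻¹

/-- The Kronecker delta. -/
noncomputable def delta (i j : Fin 2) : ℝ := if i = j then 1 else 0

@[simp] lemma delta_zero_zero : delta 0 0 = 1 := rfl
@[simp] lemma delta_one_one : delta 1 1 = 1 := rfl
@[simp] lemma delta_zero_one : delta 0 1 = 0 := rfl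
@[simp] lemma delta_one_zero : delta 1 0 = 0 := rfl

lemma bdf_eq (x : ℂ) : bdf x = 1 - (coord 0 x ^ 2 + coord 1 x ^ 2) := by
  simp [bdf, coord, Complex.normSq_apply]
  ring

lemma bdf_pos {x : ℂ} (hx : x ∈ disc) : 0 < bdf x := by
  rw [disc, mem_ball_zero_iff] at hx
  rw [bdf, Complex.normSq_eq_norm_sq]
  nlinarith [norm_nonneg x]

lemma contDiff_coord (i : Fin 2) : ContDiff ℝ ∞ (coord i) := by
  fin_cases i
  · exact Complex.reCLM.contDiff
  · exact Complex.imCLM.contDiff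

lemma contDiff_bdf : ContDiff ℝ ∞ bdf := by
  have : bdf = fun x => 1 - (coord 0 x ^ 2 + coord 1 x ^ 2) := funext bdf_eq
  rw [this]
  exact contDiff_const.sub (((contDiff_coord 0).pow 2).add ((contDiff_coord 1).pow 2))

lemma contDiff_invConf (a : ℝ) : ContDiff ℝ ∞ (invConf a) :=
  contDiff_const.mul (contDiff_bdf.pow 2)

lemma contDiffOn_logConf (k : Fin 2) : ContDiffOn ℝ ∞ (logConf k) disc :=
  (contDiff_const.mul (contDiff_coord k)).contDiffOn.mul
    (contDiff_bdf.contDiffOn.inv fun _ hx => (bdf_pos hx).ne')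

lemma pd_coord (i k : Fin 2) (x : ℂ) : pd i (coord k) x = delta i k := by
  have h0 : fderiv ℝ (coord 0) x = Complex.reCLM := Complex.reCLM.fderiv
  have h1 : fderiv ℝ (coord 1) x = Complex.imCLM := Complex.imCLM.fderiv
  fin_cases i <;> fin_cases k <;> simp [pd, h0, h1, coordVec]

lemma pd_bdf (i : Fin 2) (x : ℂ) : pd i bdf x = -2 * coord i x := by
  have hc : ∀ k, DifferentiableAt ℝ (coord k) x := fun k =>
    (contDiff_coord k).differentiable (by simp) x
  have : bdf = fun x => 1 - (coord 0 x * coord 0 x + coord 1 x * coord 1 x) := funext fun x => by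
    rw [bdf_eq]
    ring
  rw [this, pd_sub i (by fun_prop) (((hc 0).fun_mul (hc 0)).fun_add ((hc 1).fun_mul (hc 1))),
    pd_add i ((hc 0).fun_mul (hc 0)) ((hc 1).fun_mul (hc 1)), pd_mul i (hc 0) (hc 0),
    pd_mul i (hc 1) (hc 1), pd_const]
  simp only [pd_coord]
  fin_cases i <;> simp <;> ring

/-- With the metric written as `e^{2σ} δ`, `invConf` is `e^{-2σ}` and `logConf i` is `∂_i σ`. -/
lemma pd_invConf (a : ℝ) (i : Fin 2) {x : ℂ} (hx : x ∈ disc) :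
    pd i (invConf a) x = -2 * logConf i x * invConf a x := by
  have hb : DifferentiableAt ℝ bdf x := contDiff_bdf.differentiable (by simp) x
  have : invConf a = fun x => a ^ 2 / 4 * (bdf x * bdf x) := funext fun x => by
    rw [invConf, sq (bdf x)]
  rw [this, pd_const_mul i _ (hb.fun_mul hb), pd_mul i hb hb, pd_bdf, logConf]
  have := (bdf_pos hx).ne'
  field_simp
  ring

lemma pd_logConf (i k : Fin 2) {x : ℂ} (hx : x ∈ disc) :
    pd i (logConf k) x = 2 * delta i k * (bdf x)⁻¹ + logConf i x * logConf k x := by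
  have hb : DifferentiableAt ℝ bdf x := contDiff_bdf.differentiable (by simp) x
  have hc : DifferentiableAt ℝ (coord k) x := (contDiff_coord k).differentiable (by simp) x
  have h0 := (bdf_pos hx).ne'
  have h1 : logConf k = fun x => 2 * coord k x * (bdf x)⁻¹ := rfl
  rw [h1, pd_mul i (hc.const_mul 2) (hb.fun_inv h0), pd_const_mul i 2 hc, pd_inv i hb h0, pd_bdf,
    pd_coord, logConf]
  field_simp

section Metric

variable {a : ℝ} {x : ℂ}

lemma invConf_pos (ha : 0 < a) (hx : x ∈ disc) : 0 < invConf a x := by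
  have := bdf_pos hx
  rw [invConf]
  positivity

lemma hypMetric_eq (a : ℝ) (x : ℂ) : hypMetric a x = (invConf a x)⁻¹ • 1 := by
  rw [hypMetric, invConf, bdf]
  congr 1
  rw [mul_inv, inv_div, mul_comm (a ^ 2), ← div_div, div_right_comm, div_eq_mul_inv]

lemma hypMetric_apply (a : ℝ) (x : ℂ) (i j : Fin 2) :
    hypMetric a x i j = delta i j * (invConf a x)⁻¹ := by
  rw [hypMetric_eq]
  simp [Matrix.one_apply, delta]

lemma hypMetric_inv_apply (ha : 0 < a) (hx : x ∈ disc) (i j : Fin 2) :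
    (hypMetric a x)⁻¹ i j = delta i j * invConf a x := by
  have h0 := (invConf_pos ha hx).ne'
  have : (hypMetric a x)⁻¹ = invConf a x • 1 := by
    apply Matrix.inv_eq_right_inv
    rw [hypMetric_eq]
    simp [smul_smul, h0]
  rw [this]
  simp [Matrix.one_apply, delta]

lemma volDensity_hyp (ha : 0 < a) (hx : x ∈ disc) :
    volDensity (hypMetric a) x = (invConf a x)⁻¹ := by
  have h0 := invConf_pos ha hx
  rw [volDensity, hypMetric_eq, Matrix.det_smul, Matrix.det_one, mul_one, Fintype.card_fin,
    Real.sqrt_sq (by positivity)]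

lemma sharp_hyp (ha : 0 < a) (hx : x ∈ disc) (α : OneForm) (i : Fin 2) :
    sharp (hypMetric a) α x i = invConf a x * α x i := by
  simp only [sharp, hypMetric_inv_apply ha hx, Fin.sum_univ_two]
  fin_cases i <;> simp

lemma inner1_hyp (ha : 0 < a) (hx : x ∈ disc) (α η : OneForm) :
    inner1 (hypMetric a) α η x = invConf a x * (α x 0 * η x 0 + α x 1 * η x 1) := by
  simp only [inner1, hypMetric_inv_apply ha hx, Fin.sum_univ_two]
  simp
  ring

lemma inner2_hyp (ha : 0 < a) (hx : x ∈ disc) (S T : TwoTensor) :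
    inner2 (hypMetric a) S T x = invConf a x ^ 2 *
      (S x 0 0 * T x 0 0 + S x 0 1 * T x 0 1 + S x 1 0 * T x 1 0 + S x 1 1 * T x 1 1) := by
  simp only [inner2, hypMetric_inv_apply ha hx, Fin.sum_univ_two]
  simp
  ring

lemma pd_hypMetric (ha : 0 < a) (hx : x ∈ disc) (i j k : Fin 2) :
    pd i (fun y => hypMetric a y j k) x = delta j k * (2 * logConf i x * (invConf a x)⁻¹) := by
  have h0 := (invConf_pos ha hx).ne'
  have hd : DifferentiableAt ℝ (invConf a) x := (contDiff_invConf a).differentiable (by simp) x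
  simp_rw [hypMetric_apply]
  rw [pd_const_mul i _ (hd.fun_inv h0), pd_inv i hd h0, pd_invConf a i hx]
  field_simp

/-- The formula for any conformally flat metric `e^{2σ} δ`; only first derivatives of `σ` enter. -/
lemma christoffel_hyp (ha : 0 < a) (hx : x ∈ disc) (l j k : Fin 2) :
    christoffel (hypMetric a) l j k x
      = delta l j * logConf k x + delta l k * logConf j x - delta j k * logConf l x := by
  have h0 := (invConf_pos ha hx).ne'
  simp only [christoffel, hypMetric_inv_apply ha hx, pd_hypMetric ha hx, Fin.sum_univ_two]
  fin_cases l <;> fin_cases j <;> fin_cases k <;> simp <;> field_simp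

lemma pd_christoffel (ha : 0 < a) (hx : x ∈ disc) (i l j k : Fin 2) :
    pd i (christoffel (hypMetric a) l j k) x = delta l j * pd i (logConf k) x
      + delta l k * pd i (logConf j) x - delta j k * pd i (logConf l) x := by
  have hd : ∀ k, DifferentiableAt ℝ (logConf k) x := fun k =>
    differentiableAt_disc (contDiffOn_logConf k) hx
  rw [pd_congr_disc hx fun y hy => christoffel_hyp ha hy l j k,
    pd_sub i (((hd k).const_mul _).fun_add ((hd j).const_mul _)) ((hd l).const_mul _),
    pd_add i ((hd k).const_mul _) ((hd j).const_mul _), pd_const_mul i _ (hd k),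
    pd_const_mul i _ (hd j), pd_const_mul i _ (hd l)]

/-- The Poincaré disc has constant curvature `-a²`. -/
lemma ricci_hyp (ha : 0 < a) (hx : x ∈ disc) (j k : Fin 2) :
    ricci (hypMetric a) x j k = -a ^ 2 * (invConf a x)⁻¹ * delta j k := by
  have hb := (bdf_pos hx).ne'
  have e := bdf_eq x
  simp only [ricci, pd_christoffel ha hx, christoffel_hyp ha hx, pd_logConf _ _ hx,
    Fin.sum_univ_two]
  have e0 : coord 0 x ^ 2 = 1 - bdf x - coord 1 x ^ 2 := by linarith
  fin_cases j <;> fin_cases k <;> simp [logConf, invConf] <;> field_simp <;>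
    ring_nf <;> (try rw [e0]) <;> (try ring)

lemma ricciOp_hyp (ha : 0 < a) (hx : x ∈ disc) (α : OneForm) (j : Fin 2) :
    ricciOp (hypMetric a) α x j = -a ^ 2 * α x j := by
  have h0 := (invConf_pos ha hx).ne'
  simp only [ricciOp, ricci_hyp ha hx, sharp_hyp ha hx, Fin.sum_univ_two]
  fin_cases j <;> simp <;> field_simp

/-- In dimension two the volume density cancels the conformal factor of the raised index, which
leaves the Euclidean divergence up to a positive factor. -/
lemma codiff1_hyp (ha : 0 < a) (hx : x ∈ disc) (α : OneForm) :
    codiff1 (hypMetric a) α x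
      = -invConf a x * (pd 0 (fun y => α y 0) x + pd 1 (fun y => α y 1) x) := by
  have h : ∀ i, pd i (fun y => volDensity (hypMetric a) y * sharp (hypMetric a) α y i) x
      = pd i (fun y => α y i) x := fun i => pd_congr_disc hx fun y hy => by
    rw [volDensity_hyp ha hy, sharp_hyp ha hy, inv_mul_cancel_left₀ (invConf_pos ha hy).ne']
  simp only [codiff1, h, volDensity_hyp ha hx, Fin.sum_univ_two]
  rw [div_inv_eq_mul]
  ring

lemma covDeriv_hyp (ha : 0 < a) (hx : x ∈ disc) (α : OneForm) (j k : Fin 2) :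
    covDeriv (hypMetric a) α x j k = pd k (fun y => α y j) x - (logConf k x * α x j
      + logConf j x * α x k - delta j k * (logConf 0 x * α x 0 + logConf 1 x * α x 1)) := by
  simp only [covDeriv, christoffel_hyp ha hx, Fin.sum_univ_two]
  fin_cases j <;> fin_cases k <;> simp <;> ring

end Metric

section Harmonic

variable {a : ℝ} {F : ℂ → ℝ} {x : ℂ}

lemma laplaceBeltrami_hyp (ha : 0 < a) (hx : x ∈ disc) (F : ℂ → ℝ) :
    laplaceBeltrami (hypMetric a) F x
      = invConf a x * (pd 0 (pd 0 F) x + pd 1 (pd 1 F) x) := by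
  rw [laplaceBeltrami, codiff1_hyp ha hx]
  simp only [dFun]
  ring

/-- Conformal invariance: hyperbolic and Euclidean harmonicity coincide on the disc. -/
lemma IsHarmonicC1.laplacian_eq_zero (ha : 0 < a) (h : IsHarmonicC1 a F) :
    ∀ x ∈ disc, pd 0 (pd 0 F) x + pd 1 (pd 1 F) x = 0 := fun x hx => by
  have h1 := h.harmonic x hx
  rw [laplaceBeltrami_hyp ha hx] at h1
  exact (mul_eq_zero.1 h1).resolve_left (invConf_pos ha hx).ne'

/-- Partial derivatives of harmonic functions are harmonic. -/
lemma laplacian_pd_eq_zero (hF : ContDiffOn ℝ ∞ F disc)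
    (hL : ∀ x ∈ disc, pd 0 (pd 0 F) x + pd 1 (pd 1 F) x = 0) (j : Fin 2) (hx : x ∈ disc) :
    pd 0 (pd 0 (pd j F)) x + pd 1 (pd 1 (pd j F)) x = 0 := by
  have h1 : ∀ i, pd i (pd i (pd j F)) x = pd j (pd i (pd i F)) x := fun i => by
    rw [pd_congr_disc hx fun y hy => pd_pd_comm i j hF hy]
    exact pd_pd_comm i j (contDiffOn_pd i hF) hx
  rw [h1, h1, ← pd_add j (differentiableAt_disc (contDiffOn_pd 0 (contDiffOn_pd 0 hF)) hx)
    (differentiableAt_disc (contDiffOn_pd 1 (contDiffOn_pd 1 hF)) hx),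
    pd_congr_disc hx hL, pd_const]

lemma contDiffOn_covDeriv (ha : 0 < a) (hF : ContDiffOn ℝ ∞ F disc) (j k : Fin 2) :
    ContDiffOn ℝ ∞ (fun x => covDeriv (hypMetric a) (dFun F) x j k) disc := by
  have h1 := fun i => contDiffOn_pd i hF
  have h2 := fun i => contDiffOn_logConf i
  refine ContDiffOn.congr ?_ fun x hx => covDeriv_hyp ha hx (dFun F) j k
  exact (contDiffOn_pd k (h1 j)).sub ((((h2 k).mul (h1 j)).add ((h2 j).mul (h1 k))).sub
    (contDiffOn_const.mul (((h2 0).mul (h1 0)).add ((h2 1).mul (h1 1)))))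

/-- Because of this symmetry the deformation tensor of `dF` is all of `∇dF`. -/
lemma covDeriv_dFun_symm (ha : 0 < a) (hF : ContDiffOn ℝ ∞ F disc) (hx : x ∈ disc) (j k : Fin 2) :
    covDeriv (hypMetric a) (dFun F) x j k = covDeriv (hypMetric a) (dFun F) x k j := by
  rw [covDeriv_hyp ha hx, covDeriv_hyp ha hx]
  have h := pd_pd_comm j k hF hx
  simp only [dFun]
  rw [h]
  fin_cases j <;> fin_cases k <;> simp <;> ring

/-- The Christoffel terms cancel in the trace, leaving the Euclidean Laplacian of `F`. -/
lemma covDeriv_dFun_trace (ha : 0 < a) (hL : ∀ x ∈ disc, pd 0 (pd 0 F) x + pd 1 (pd 1 F) x = 0)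
    (hx : x ∈ disc) : covDeriv (hypMetric a) (dFun F) x 1 1
      = -covDeriv (hypMetric a) (dFun F) x 0 0 := by
  rw [covDeriv_hyp ha hx, covDeriv_hyp ha hx]
  have h := hL x hx
  simp only [dFun, delta_zero_zero, delta_one_one]
  linear_combination h

/-- The divergence of the Hessian of a harmonic function. -/
lemma div_covDeriv (ha : 0 < a) (hF : ContDiffOn ℝ ∞ F disc)
    (hL : ∀ x ∈ disc, pd 0 (pd 0 F) x + pd 1 (pd 1 F) x = 0) (hx : x ∈ disc) (j : Fin 2) :
    pd 0 (fun y => covDeriv (hypMetric a) (dFun F) y j 0) x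
      + pd 1 (fun y => covDeriv (hypMetric a) (dFun F) y j 1) x
      = -a ^ 2 * (invConf a x)⁻¹ * pd j F x := by
  have h1 : ∀ i, DifferentiableAt ℝ (pd i F) x := fun i =>
    differentiableAt_disc (contDiffOn_pd i hF) hx
  have h2 : ∀ i j, DifferentiableAt ℝ (pd i (pd j F)) x := fun i j =>
    differentiableAt_disc (contDiffOn_pd i (contDiffOn_pd j hF)) hx
  have h3 : ∀ i, DifferentiableAt ℝ (logConf i) x := fun i =>
    differentiableAt_disc (contDiffOn_logConf i) hx
  have key : ∀ k, pd k (fun y => covDeriv (hypMetric a) (dFun F) y j k) x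
      = pd k (pd k (pd j F)) x - ((pd k (logConf k) x * pd j F x + logConf k x * pd k (pd j F) x)
        + (pd k (logConf j) x * pd k F x + logConf j x * pd k (pd k F) x)
        - delta j k * ((pd k (logConf 0) x * pd 0 F x + logConf 0 x * pd k (pd 0 F) x)
          + (pd k (logConf 1) x * pd 1 F x + logConf 1 x * pd k (pd 1 F) x))) := fun k => by
    rw [pd_congr_disc hx fun y hy => covDeriv_hyp ha hy (dFun F) j k]
    have m := fun i j => (h3 i).fun_mul (h1 j)
    have e := fun i j => pd_mul k (h3 i) (h1 j)
    simp only [dFun]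
    rw [pd_sub k (h2 k j) (((m k j).fun_add (m j k)).fun_sub
        (((m 0 0).fun_add (m 1 1)).const_mul _)),
      pd_sub k ((m k j).fun_add (m j k)) (((m 0 0).fun_add (m 1 1)).const_mul _),
      pd_add k (m k j) (m j k), pd_const_mul k _ ((m 0 0).fun_add (m 1 1)),
      pd_add k (m 0 0) (m 1 1), e, e, e, e]
  have hsy := pd_pd_comm 0 1 hF hx
  have hl := laplacian_pd_eq_zero hF hL j hx
  have hl2 := hL x hx
  -- Liouville's equation `Δσ = a² e^{2σ}` is where the curvature enters. Third derivatives cancel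
  -- by harmonicity of `∂_j F`, and the terms in `∂_i ∂_k F` cancel among themselves, so `-Δσ ∂_j F`
  -- is all that remains.
  have hconf : pd 0 (logConf 0) x + pd 1 (logConf 1) x = a ^ 2 * (invConf a x)⁻¹ := by
    have hb := (bdf_pos hx).ne'
    have e0 : coord 0 x ^ 2 = 1 - bdf x - coord 1 x ^ 2 := by linarith [bdf_eq x]
    rw [pd_logConf _ _ hx, pd_logConf _ _ hx]
    simp [logConf, invConf]
    field_simp
    linear_combination 4 * e0
  have hcomm : pd 0 (logConf 1) x = pd 1 (logConf 0) x := by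
    rw [pd_logConf _ _ hx, pd_logConf _ _ hx]
    simp [mul_comm]
  rw [key, key, neg_mul, ← hconf]
  fin_cases j <;> simp at hl ⊢
  · linear_combination hl - logConf 0 x * hl2 + logConf 1 x * hsy + pd 1 F x * hcomm
  · linear_combination hl - logConf 1 x * hl2 - logConf 0 x * hsy - pd 0 F x * hcomm

end Harmonic

/-! ### The explicit smooth solutions -/

section Smooth

variable {a A : ℝ} {F : ℂ → ℝ} {x : ℂ}

lemma contDiff_psi (A : ℝ) : ContDiff ℝ ∞ (psi A) := by
  unfold psi
  fun_prop

lemma hasDerivAt_psi (A t : ℝ) : HasDerivAt (psi A) (-(A / 2) * psi A t) t := by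
  have h : HasDerivAt (fun t : ℝ => -(A * t) / 2) (-(A / 2)) t := by
    refine ((((hasDerivAt_id t).const_mul A).neg).div_const 2).congr_deriv ?_
    ring
  exact h.exp.congr_deriv (mul_comm _ _)

lemma pressure_eq (ha : 0 < a) (hx : x ∈ disc) (t : ℝ) :
    pressure a A F t x = (A / 2 - 2 * a ^ 2) * psi A t * F x
      + -(1 / 2) * psi A t ^ 2 * (invConf a x * (pd 0 F x * pd 0 F x + pd 1 F x * pd 1 F x)) := by
  rw [pressure, (hasDerivAt_psi A t).deriv, inner1_hyp ha hx]
  simp only [dFun]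
  ring

lemma contDiffOn_velocity (A : ℝ) (hF : ContDiffOn ℝ ∞ F disc) :
    ContDiffOn ℝ ∞ (fun p : ℝ × ℂ => velocity A F p.1 p.2) (Ici 0 ×ˢ disc) := by
  rw [contDiffOn_pi]
  intro j
  exact ((contDiff_psi A).comp contDiff_fst).contDiffOn.mul
    ((contDiffOn_pd j hF).comp contDiff_snd.contDiffOn fun p hp => hp.2)

lemma contDiffOn_pressure (ha : 0 < a) (A : ℝ) (hF : ContDiffOn ℝ ∞ F disc) :
    ContDiffOn ℝ ∞ (fun p : ℝ × ℂ => pressure a A F p.1 p.2) (Ici 0 ×ˢ disc) := by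
  refine ContDiffOn.congr ?_ fun p hp => pressure_eq ha hp.2 p.1
  have hpsi : ContDiffOn ℝ ∞ (fun p : ℝ × ℂ => psi A p.1) (Ici 0 ×ˢ disc) :=
    ((contDiff_psi A).comp contDiff_fst).contDiffOn
  have hs : ∀ {f : ℂ → ℝ}, ContDiffOn ℝ ∞ f disc →
      ContDiffOn ℝ ∞ (fun p : ℝ × ℂ => f p.2) (Ici 0 ×ˢ disc) := fun hf =>
    hf.comp contDiff_snd.contDiffOn fun p hp => hp.2
  have h1 := fun i => hs (contDiffOn_pd i hF)
  exact ((contDiffOn_const.mul hpsi).mul (hs hF)).add ((contDiffOn_const.mul (hpsi.pow 2)).mul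
    ((hs (contDiff_invConf a).contDiffOn).mul (((h1 0).mul (h1 0)).add ((h1 1).mul (h1 1)))))

lemma pd_velocity (t : ℝ) (hF : ContDiffOn ℝ ∞ F disc) (hx : x ∈ disc) (i j : Fin 2) :
    pd i (fun y => velocity A F t y j) x = psi A t * pd i (pd j F) x :=
  pd_const_mul i _ (differentiableAt_disc (contDiffOn_pd j hF) hx)

lemma codiff1_velocity (ha : 0 < a) (hF : ContDiffOn ℝ ∞ F disc)
    (hL : ∀ x ∈ disc, pd 0 (pd 0 F) x + pd 1 (pd 1 F) x = 0) (hx : x ∈ disc) (t : ℝ) :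
    codiff1 (hypMetric a) (velocity A F t) x = 0 := by
  rw [codiff1_hyp ha hx, pd_velocity t hF hx, pd_velocity t hF hx, ← mul_add, hL x hx, mul_zero,
    mul_zero]

/-- Closed and coclosed 1-forms are annihilated by the Hodge Laplacian. -/
lemma hodgeLaplacian_eq_zero {g : MetricField} {α : OneForm}
    (h1 : ∀ y ∈ disc, codiff1 g α y = 0) (h2 : ∀ y ∈ disc, ∀ i j, extDeriv1 α y i j = 0)
    (hx : x ∈ disc) (j : Fin 2) : hodgeLaplacian g α x j = 0 := by
  have h3 : dFun (codiff1 g α) x j = 0 := by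
    rw [dFun, pd_congr_disc hx h1, pd_const]
  have h4 : codiff2 g (extDeriv1 α) x j = 0 := by
    have : ∀ k l, pd k (fun y => volDensity g y * raise2 g (extDeriv1 α) y k l) x = 0 := by
      intro k l
      rw [pd_congr_disc hx (g := fun _ => 0) fun y hy => by simp [raise2, h2 y hy], pd_const]
    simp [codiff2, this]
  rw [hodgeLaplacian, h3, h4, add_zero, neg_zero]

/-- The sum of `∂_t U`, `½ d|U|²` and `2a² U` is `-dP`. Any rate `A` is allowed: a lower bound
matters only for the energy inequality. -/
theorem isSmoothSolution_velocity (ha : 0 < a) (A : ℝ) (hF : ContDiffOn ℝ ∞ F disc)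
    (hL : ∀ x ∈ disc, pd 0 (pd 0 F) x + pd 1 (pd 1 F) x = 0) :
    IsSmoothSolution (hypMetric a) disc (velocity A F) (pressure a A F) where
  smooth_velocity := contDiffOn_velocity A hF
  smooth_pressure := contDiffOn_pressure ha A hF
  divFree t _ x hx := codiff1_velocity ha hF hL hx t
  momentum t _ x hx j := by
    have h1 : ∀ i, DifferentiableAt ℝ (pd i F) x := fun i =>
      differentiableAt_disc (contDiffOn_pd i hF) hx
    have hρ : DifferentiableAt ℝ (invConf a) x := (contDiff_invConf a).differentiable (by simp) x
    have ht : timeDeriv (velocity A F) t x j = -(A / 2) * psi A t * pd j F x :=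
      ((hasDerivAt_psi A t).mul_const (pd j F x)).deriv
    have hH : hodgeLaplacian (hypMetric a) (velocity A F t) x j = 0 :=
      hodgeLaplacian_eq_zero (fun y hy => codiff1_velocity ha hF hL hy t)
        (fun y hy i k => by
          rw [extDeriv1, pd_velocity t hF hy, pd_velocity t hF hy, pd_pd_comm i k hF hy, sub_self])
        hx j
    have m := fun i => (h1 i).fun_mul (h1 i)
    have hP : dFun (pressure a A F t) x j = (A / 2 - 2 * a ^ 2) * psi A t * pd j F x
        + -(1 / 2) * psi A t ^ 2 * (-2 * logConf j x * invConf a x *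
            (pd 0 F x * pd 0 F x + pd 1 F x * pd 1 F x)
          + invConf a x * ((pd j (pd 0 F) x * pd 0 F x + pd 0 F x * pd j (pd 0 F) x)
            + (pd j (pd 1 F) x * pd 1 F x + pd 1 F x * pd j (pd 1 F) x))) := by
      rw [dFun, pd_congr_disc hx fun y hy => pressure_eq ha hy t,
        pd_add j ((differentiableAt_disc hF hx).const_mul _)
          ((hρ.fun_mul ((m 0).fun_add (m 1))).const_mul _),
        pd_const_mul j _ (differentiableAt_disc hF hx),
        pd_const_mul j _ (hρ.fun_mul ((m 0).fun_add (m 1))),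
        pd_mul j hρ ((m 0).fun_add (m 1)), pd_add j (m 0) (m 1), pd_mul j (h1 0) (h1 0),
        pd_mul j (h1 1) (h1 1), pd_invConf a j hx]
    have hsy := pd_pd_comm 0 1 hF hx
    rw [ht, hH, ricciOp_hyp ha hx, hP, covDerivAlong]
    simp only [Fin.sum_univ_two, sharp_hyp ha hx, covDeriv_hyp ha hx, pd_velocity t hF hx]
    simp only [velocity, dFun]
    fin_cases j <;> simp <;> rw [hsy] <;> ring

end Smooth

/-! ### Test functions on the disc -/

section TestFunctions

variable {u v w : ℂ → ℝ}

lemma IsTestFunction.add (hu : IsTestFunction disc u) (hv : IsTestFunction disc v) :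
    IsTestFunction disc fun x => u x + v x :=
  ⟨hu.1.add hv.1, hu.2.1.add hv.2.1,
    (tsupport_add u v).trans (union_subset hu.2.2 hv.2.2)⟩

/-- A function smooth on the disc times a test function, extended by zero. -/
lemma IsTestFunction.smooth_mul (hv : IsTestFunction disc v) (hw : ContDiffOn ℝ ∞ w disc) :
    IsTestFunction disc fun x => w x * v x := by
  have hsub : tsupport (fun x => w x * v x) ⊆ tsupport v := tsupport_mul_subset_right
  refine ⟨contDiff_iff_contDiffAt.2 fun x => ?_, hv.2.1.mul_left, hsub.trans hv.2.2⟩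
  by_cases hx : x ∈ tsupport v
  · exact (hw.contDiffAt (isOpen_disc.mem_nhds (hv.2.2 hx))).mul hv.1.contDiffAt
  · refine (contDiffAt_const (c := (0 : ℝ))).congr_of_eventuallyEq ?_
    filter_upwards [notMem_tsupport_iff_eventuallyEq.1 hx] with y hy
    simp [hy]

lemma IsTestFunction.const_mul (hv : IsTestFunction disc v) (c : ℝ) :
    IsTestFunction disc fun x => c * v x :=
  hv.smooth_mul contDiffOn_const

lemma tsupport_pd_subset (i : Fin 2) (v : ℂ → ℝ) : tsupport (pd i v) ⊆ tsupport v := by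
  refine closure_minimal (fun x hx => ?_) (isClosed_tsupport v)
  refine support_fderiv_subset ℝ (f := v) fun h0 => hx ?_
  simp [pd, h0]

lemma IsTestFunction.pd (hv : IsTestFunction disc v) (i : Fin 2) :
    IsTestFunction disc (pd i v) :=
  ⟨contDiff_pd i hv.1, hv.2.1.of_isClosed_subset (isClosed_tsupport _) (tsupport_pd_subset i v),
    (tsupport_pd_subset i v).trans hv.2.2⟩

lemma IsTestFunction.integrable (hv : IsTestFunction disc v) : Integrable v :=
  hv.1.continuous.integrable_of_hasCompactSupport hv.2.1

lemma IsTestFunction.setIntegral_eq (hv : IsTestFunction disc v) :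
    ∫ x in disc, v x = ∫ x, v x :=
  setIntegral_eq_integral_of_forall_compl_eq_zero fun _ hx =>
    image_eq_zero_of_notMem_tsupport fun h => hx (hv.2.2 h)

lemma IsTestFunction.setIntegral_pd (hv : IsTestFunction disc v) (i : Fin 2) :
    ∫ x in disc, HypNS.pd i v x = 0 := by
  rw [(hv.pd i).setIntegral_eq]
  -- Integration by parts against the constant `1`, of which only the products with `v` and its
  -- derivative need be integrable.
  have h := integral_mul_fderiv_eq_neg_fderiv_mul_of_integrable (μ := (volume : Measure ℂ))
    (f := fun _ : ℂ => (1 : ℝ)) (g := v) (v := coordVec i) (by simp)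
    (by simpa [HypNS.pd] using! (hv.pd i).integrable) (by simpa using hv.integrable)
    (fun _ _ => by fun_prop) (fun _ _ => hv.1.differentiable (by simp) _)
  simpa [HypNS.pd] using h

/-- The divergence theorem for compactly supported vector fields. -/
lemma setIntegral_div_eq_zero (hu : IsTestFunction disc u) (hv : IsTestFunction disc v) :
    ∫ x in disc, (pd 0 u x + pd 1 v x) = 0 := by
  rw [integral_add (hu.pd 0).integrable.integrableOn (hv.pd 1).integrable.integrableOn,
    hu.setIntegral_pd, hv.setIntegral_pd, add_zero]

lemma IsTestFunction.differentiableAt (hv : IsTestFunction disc v) (x : ℂ) :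
    DifferentiableAt ℝ v x := hv.1.differentiable (by simp) x

end TestFunctions

/-! ### Integration against the hyperbolic area -/

section Area

variable {a : ℝ}

/-- Valid on all of `ℂ`, with both sides equal to the default value `0` on the unit circle; this
gives measurability of the density without restricting to the disc. -/
lemma volDensity_hypMetric (a : ℝ) : volDensity (hypMetric a) = fun x => (invConf a x)⁻¹ := by
  funext x
  have h0 : 0 ≤ invConf a x := by
    rw [invConf]
    positivity
  rw [volDensity, hypMetric_eq, Matrix.det_smul, Matrix.det_one, mul_one, Fintype.card_fin,
    Real.sqrt_sq (by positivity)]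

lemma measurable_volDensity (a : ℝ) :
    Measurable fun x => ENNReal.ofReal (volDensity (hypMetric a) x) := by
  rw [volDensity_hypMetric]
  exact ((contDiff_invConf a).continuous.measurable.inv).ennreal_ofReal

lemma integral_vol (ha : 0 < a) (f : ℂ → ℝ) :
    ∫ x, f x ∂(vol (hypMetric a) disc) = ∫ x in disc, (invConf a x)⁻¹ * f x := by
  rw [vol, integral_withDensity_eq_integral_toReal_smul (measurable_volDensity a)
    (ae_of_all _ fun _ => ENNReal.ofReal_lt_top)]
  refine setIntegral_congr_fun isOpen_disc.measurableSet fun x hx => ?_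
  simp only [volDensity_hyp ha hx]
  rw [ENNReal.toReal_ofReal (inv_nonneg.2 (invConf_pos ha hx).le), smul_eq_mul]

lemma lintegral_vol (ha : 0 < a) (f : ℂ → ℝ) :
    ∫⁻ x, ENNReal.ofReal (f x) ∂(vol (hypMetric a) disc)
      = ∫⁻ x in disc, ENNReal.ofReal ((invConf a x)⁻¹ * f x) := by
  rw [vol, lintegral_withDensity_eq_lintegral_mul_non_measurable _ (measurable_volDensity a)
    (ae_of_all _ fun _ => ENNReal.ofReal_lt_top)]
  refine setLIntegral_congr_fun isOpen_disc.measurableSet fun x hx => ?_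
  simp only [Pi.mul_apply, volDensity_hyp ha hx]
  rw [ENNReal.ofReal_mul (inv_nonneg.2 (invConf_pos ha hx).le)]

lemma vol_absolutelyContinuous (a : ℝ) :
    vol (hypMetric a) disc ≪ volume.restrict disc := withDensity_absolutelyContinuous _ _

lemma absolutelyContinuous_vol (ha : 0 < a) :
    volume.restrict disc ≪ vol (hypMetric a) disc := by
  refine withDensity_absolutelyContinuous' (measurable_volDensity a).aemeasurable ?_
  filter_upwards [ae_restrict_mem isOpen_disc.measurableSet] with x hx
  rw [volDensity_hyp ha hx]
  exact (ENNReal.ofReal_pos.2 (inv_pos.2 (invConf_pos ha hx))).ne'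

lemma aestronglyMeasurable_vol {E : Type*} [NormedAddCommGroup E] [SecondCountableTopology E]
    {f : ℂ → E} (hf : ContinuousOn f disc) :
    AEStronglyMeasurable f (vol (hypMetric a) disc) := by
  borelize E
  exact (hf.aestronglyMeasurable isOpen_disc.measurableSet).mono_ac (vol_absolutelyContinuous a)

end Area

/-! ### Weak derivatives and the weak form of the equation -/

section Weak

variable {a : ℝ} {F : ℂ → ℝ}

/-- The Christoffel terms cancel, and what remains is `∫ ∂_k (α_j η) = 0`. -/
lemma isWeakCovDeriv_of_smooth {α : OneForm} {T : TwoTensor}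
    (hα : ∀ j, ContDiffOn ℝ ∞ (fun x => α x j) disc)
    (hT : ∀ j k, ContinuousOn (fun x => T x j k) disc)
    (hTα : ∀ x ∈ disc, T x = covDeriv (hypMetric a) α x) :
    IsWeakCovDeriv (hypMetric a) disc α T := by
  intro j k
  refine ⟨(hα j).continuousOn.locallyIntegrableOn isOpen_disc.measurableSet,
    (hT j k).locallyIntegrableOn isOpen_disc.measurableSet, fun η hη => ?_⟩
  have h1 : ∫ x in disc, (T x j k + ∑ l, christoffel (hypMetric a) l j k x * α x l) * η x
      = ∫ x in disc, pd k (fun y => α y j) x * η x :=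
    setIntegral_congr_fun isOpen_disc.measurableSet fun x hx => by
      simp only [hTα x hx, covDeriv, sub_add_cancel]
  rw [h1, eq_neg_iff_add_eq_zero,
    ← integral_add ((hη.pd k).smooth_mul (hα j)).integrable.integrableOn
      (hη.smooth_mul (contDiffOn_pd k (hα j))).integrable.integrableOn,
    ← (hη.smooth_mul (hα j)).setIntegral_pd k]
  refine setIntegral_congr_fun isOpen_disc.measurableSet fun x hx => ?_
  rw [pd_mul k (differentiableAt_disc (hα j) hx) (hη.differentiableAt x)]
  ring

lemma isWeaklyDivFree_velocity (ha : 0 < a) (hF : ContDiffOn ℝ ∞ F disc)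
    (hL : ∀ x ∈ disc, pd 0 (pd 0 F) x + pd 1 (pd 1 F) x = 0) (c : ℝ) :
    IsWeaklyDivFree (hypMetric a) disc fun x j => c * dFun F x j := by
  intro η hη
  have h1 := fun i => contDiffOn_pd i hF
  -- Since `F` is harmonic, the integrand is the Euclidean divergence of `c η ∇F`.
  rw [integral_vol ha, ← setIntegral_div_eq_zero
    ((hη.smooth_mul (h1 0)).const_mul c) ((hη.smooth_mul (h1 1)).const_mul c)]
  refine setIntegral_congr_fun isOpen_disc.measurableSet fun x hx => ?_
  have d1 := fun i => differentiableAt_disc (h1 i) hx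
  have hη' := hη.differentiableAt x
  have h0 := (invConf_pos ha hx).ne'
  simp only [inner1_hyp ha hx, dFun]
  rw [pd_const_mul 0 _ ((d1 0).fun_mul hη'), pd_const_mul 1 _ ((d1 1).fun_mul hη'),
    pd_mul 0 (d1 0) hη', pd_mul 1 (d1 1) hη', inv_mul_cancel_left₀ h0]
  linear_combination -(c * η x) * hL x hx

/-- A slice of a compactly supported smooth function on space-time. -/
lemma isTestFunction_slice {Ψ : ℝ × ℂ → ℝ} (h1 : ContDiff ℝ ∞ Ψ) (h2 : HasCompactSupport Ψ)
    (h3 : tsupport Ψ ⊆ Ioi 0 ×ˢ disc) (t : ℝ) : IsTestFunction disc fun x => Ψ (t, x) := by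
  have hemb : IsClosedEmbedding fun x : ℂ => (t, x) := by
    refine IsClosedEmbedding.of_continuous_injective_isClosedMap (by fun_prop)
      (fun x y h => (Prod.mk.inj h).2) fun s hs => ?_
    have : (fun x : ℂ => (t, x)) '' s = {t} ×ˢ s := by
      rw [singleton_prod]
    rw [this]
    exact isClosed_singleton.prod hs
  refine ⟨h1.comp (contDiff_const.prodMk contDiff_id), h2.comp_isClosedEmbedding hemb, fun x hx => ?_⟩
  exact (h3 (tsupport_comp_subset_preimage Ψ hemb.continuous hx)).2

/-- The components and their time derivatives of a divergence free test form are, at each time,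
divergence free vector fields of test functions. -/
lemma IsDivFreeTestForm.slice (ha : 0 < a) {φ : ℝ → OneForm}
    (hφ : IsDivFreeTestForm (hypMetric a) disc φ) (t : ℝ) :
    (∀ j, IsTestFunction disc fun x => φ t x j) ∧
    (∀ j, IsTestFunction disc fun x => timeDeriv φ t x j) ∧
    (∀ x ∈ disc, pd 0 (fun y => φ t y 0) x + pd 1 (fun y => φ t y 1) x = 0) ∧
    ∀ x ∈ disc, pd 0 (fun y => timeDeriv φ t y 0) x + pd 1 (fun y => timeDeriv φ t y 1) x = 0 := by
  obtain ⟨hs, hc, ht, hd⟩ := hφ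
  set Ψ : Fin 2 → ℝ × ℂ → ℝ := fun j p => φ p.1 p.2 j with hΨ
  have hΨs : ∀ j, ContDiff ℝ ∞ (Ψ j) := fun j => contDiff_pi.1 hs j
  have hsub : ∀ j, tsupport (Ψ j) ⊆ tsupport (fun p : ℝ × ℂ => φ p.1 p.2) := fun j =>
    closure_mono fun p hp h0 => hp (by simpa [hΨ] using congrFun h0 j)
  have hΨc : ∀ j, HasCompactSupport (Ψ j) := fun j =>
    hc.of_isClosed_subset (isClosed_tsupport _) (hsub j)
  set Χ : Fin 2 → ℝ × ℂ → ℝ := fun j p => fderiv ℝ (Ψ j) p (1, 0) with hΧ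
  have hΧs : ∀ j, ContDiff ℝ ∞ (Χ j) := fun j =>
    ((hΨs j).fderiv_right (by simp)).clm_apply contDiff_const
  have hsub' : ∀ j, tsupport (Χ j) ⊆ tsupport (Ψ j) := fun j => by
    refine closure_minimal (fun x hx => ?_) (isClosed_tsupport _)
    refine support_fderiv_subset ℝ (f := Ψ j) fun h0 => hx ?_
    simp [hΧ, h0]
  have hΧc : ∀ j, HasCompactSupport (Χ j) := fun j =>
    (hΨc j).of_isClosed_subset (isClosed_tsupport _) (hsub' j)
  have hdiff : ∀ j p, DifferentiableAt ℝ (Ψ j) p := fun j p =>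
    (hΨs j).differentiable (by simp) p
  have htime : ∀ s x j, HasDerivAt (fun s => φ s x j) (Χ j (s, x)) s := fun s x j => by
    have := (hdiff j (s, x)).hasFDerivAt.comp_hasDerivAt s
      ((hasDerivAt_id s).prodMk (hasDerivAt_const s x))
    exact this
  have hTD : ∀ s x j, timeDeriv φ s x j = Χ j (s, x) := fun s x j => (htime s x j).deriv
  have hspace : ∀ {f : ℝ × ℂ → ℝ}, Differentiable ℝ f → ∀ s i x,
      pd i (fun y => f (s, y)) x = fderiv ℝ f (s, x) (0, coordVec i) := by
    intro f hf s i x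
    have := (hf (s, x)).hasFDerivAt.comp x ((hasFDerivAt_const s x).prodMk (hasFDerivAt_id x))
    have h2 : fderiv ℝ (fun y => f (s, y)) x = _ := this.fderiv
    rw [pd, h2]
    simp
  have hdiv : ∀ s, ∀ x ∈ disc,
      pd 0 (fun y => φ s y 0) x + pd 1 (fun y => φ s y 1) x = 0 := fun s x hx => by
    have h := hd s x hx
    rw [codiff1_hyp ha hx] at h
    exact (mul_eq_zero.1 h).resolve_left (neg_ne_zero.2 (invConf_pos ha hx).ne')
  refine ⟨fun j => isTestFunction_slice (hΨs j) (hΨc j) ((hsub j).trans ht) t, fun j => ?_,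
    hdiv t, fun x hx => ?_⟩
  · simp_rw [hTD]
    exact isTestFunction_slice (hΧs j) (hΧc j) (((hsub' j).trans (hsub j)).trans ht) t
  -- Mixed space-time derivatives commute, so the divergence of the time derivative is the time
  -- derivative of a function of `t` that is identically zero.
  · have hmix : ∀ j, HasDerivAt (fun s => pd j (fun y => φ s y j) x)
        (pd j (fun y => timeDeriv φ t y j) x) t := by
      intro j
      simp_rw [hTD]
      have e1 : (fun s => pd j (fun y => φ s y j) x)
          = fun s => fderiv ℝ (Ψ j) (s, x) (0, coordVec j) := funext fun s =>
        hspace ((hΨs j).differentiable (by simp)) s j x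
      rw [hspace ((hΧs j).differentiable (by simp)), e1]
      have hdd : DifferentiableAt ℝ (fderiv ℝ (Ψ j)) (t, x) :=
        ((hΨs j).fderiv_right (m := ∞) (by simp)).differentiable (by simp) _
      have hsym : IsSymmSndFDerivAt ℝ (Ψ j) (t, x) :=
        (hΨs j).contDiffAt.isSymmSndFDerivAt (by simp; exact WithTop.coe_le_coe.2 le_top)
      have e2 : fderiv ℝ (Χ j) (t, x) (0, coordVec j)
          = fderiv ℝ (fderiv ℝ (Ψ j)) (t, x) (1, 0) (0, coordVec j) := by
        rw [hΧ]
        simp only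
        rw [fderiv_clm_apply hdd (differentiableAt_const _)]
        simp
        exact hsym _ _
      rw [e2]
      have h5 := hdd.hasFDerivAt.comp_hasDerivAt t
        ((hasDerivAt_id t).prodMk (hasDerivAt_const t x))
      exact h5.clm_apply (hasDerivAt_const t ((0 : ℝ), coordVec j)) |>.congr_deriv (by simp)
    have h6 := (hmix 0).add (hmix 1)
    have h7 : (fun s => pd 0 (fun y => φ s y 0) x) + (fun s => pd 1 (fun y => φ s y 1) x)
        = fun _ => 0 := funext fun s => hdiv s x hx
    rw [h7] at h6
    exact h6.unique (hasDerivAt_const t 0)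

/-- The weak form of the equation holds at every time. -/
lemma integral_momentum_slice (ha : 0 < a) (hF : ContDiffOn ℝ ∞ F disc)
    (hL : ∀ x ∈ disc, pd 0 (pd 0 F) x + pd 1 (pd 1 F) x = 0) (c : ℝ) {φ χ : OneForm}
    (hφ : ∀ j, IsTestFunction disc fun x => φ x j) (hχ : ∀ j, IsTestFunction disc fun x => χ x j)
    (hdφ : ∀ x ∈ disc, pd 0 (fun y => φ y 0) x + pd 1 (fun y => φ y 1) x = 0)
    (hdχ : ∀ x ∈ disc, pd 0 (fun y => χ y 0) x + pd 1 (fun y => χ y 1) x = 0) :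
    ∫ x, (-inner1 (hypMetric a) (fun x j => c * dFun F x j) χ x
      + 2 * inner2 (hypMetric a)
          (symPart fun x j k => c * covDeriv (hypMetric a) (dFun F) x j k)
          (deform (hypMetric a) φ) x
      - inner1 (hypMetric a) (fun x j => c * dFun F x j)
          (covDerivAlong (hypMetric a) (fun x j => c * dFun F x j) φ) x)
      ∂(vol (hypMetric a) disc) = 0 := by
  set S : Fin 2 → Fin 2 → ℂ → ℝ := fun j k x => covDeriv (hypMetric a) (dFun F) x j k with hS
  have cF := fun i => contDiffOn_pd i hF
  have cS : ∀ j k, ContDiffOn ℝ ∞ (S j k) disc := fun j k => contDiffOn_covDeriv ha hF j k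
  have cρ : ContDiffOn ℝ ∞ (invConf a) disc := (contDiff_invConf a).contDiffOn
  set N : ℂ → ℝ := fun x => pd 0 F x * pd 0 F x + pd 1 F x * pd 1 F x with hN
  have cN : ContDiffOn ℝ ∞ N disc := ((cF 0).mul (cF 0)).add ((cF 1).mul (cF 1))
  set w : Fin 2 → Fin 2 → ℂ → ℝ := fun j k x =>
    invConf a x * (2 * c * S j k x - c ^ 2 * (pd k F x * pd j F x)) with hw
  have cw : ∀ j k, ContDiffOn ℝ ∞ (w j k) disc := fun j k =>
    cρ.mul ((contDiffOn_const.mul (cS j k)).sub (contDiffOn_const.mul ((cF k).mul (cF j))))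
  set m : ℂ → ℝ := fun x => 2 * c * a ^ 2 * F x + c ^ 2 / 2 * (invConf a x * N x) with hm
  have cm : ContDiffOn ℝ ∞ m disc :=
    (contDiffOn_const.mul hF).add (contDiffOn_const.mul (cρ.mul cN))
  -- The integrand times the volume density is the divergence of `V`. The first term handles `⟨dF,
  -- χ⟩`, as `χ` is divergence free; `w` integrates the viscous and convective terms by parts; the
  -- resulting differential is cancelled by that of `m = 2a² c F + ½ c² |dF|²`, paired with the
  -- divergence free `φ`. Up to sign `m` is the pressure without its `ψ'` part.
  set V : Fin 2 → ℂ → ℝ := fun k x =>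
    -c * F x * χ x k + (w 0 k x * φ x 0 + w 1 k x * φ x 1) + m x * φ x k with hV
  have hVt : ∀ k, IsTestFunction disc (V k) := fun k =>
    (((hχ k).smooth_mul (contDiffOn_const.mul hF)).add
      (((hφ 0).smooth_mul (cw 0 k)).add ((hφ 1).smooth_mul (cw 1 k)))).add ((hφ k).smooth_mul cm)
  rw [integral_vol ha, ← setIntegral_div_eq_zero (hVt 0) (hVt 1)]
  refine setIntegral_congr_fun isOpen_disc.measurableSet fun x hx => ?_
  have h0 := (invConf_pos ha hx).ne'
  have dF0 := differentiableAt_disc hF hx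
  have dF := fun i => differentiableAt_disc (cF i) hx
  have dS := fun j k => differentiableAt_disc (cS j k) hx
  have dρ := differentiableAt_disc cρ hx
  have dN := differentiableAt_disc cN hx
  have dw := fun j k => differentiableAt_disc (cw j k) hx
  have dm := differentiableAt_disc cm hx
  have dφ := fun j => (hφ j).differentiableAt x
  have dχ := fun j => (hχ j).differentiableAt x
  have hVpd : ∀ k, pd k (V k) x = -c * (pd k F x * χ x k + F x * pd k (fun y => χ y k) x)
      + ((pd k (w 0 k) x * φ x 0 + w 0 k x * pd k (fun y => φ y 0) x)
        + (pd k (w 1 k) x * φ x 1 + w 1 k x * pd k (fun y => φ y 1) x))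
      + (pd k m x * φ x k + m x * pd k (fun y => φ y k) x) := fun k => by
    rw [hV]
    simp only
    rw [pd_add k (((dF0.const_mul _).fun_mul (dχ k)).fun_add
        (((dw 0 k).fun_mul (dφ 0)).fun_add ((dw 1 k).fun_mul (dφ 1)))) (dm.fun_mul (dφ k)),
      pd_add k ((dF0.const_mul _).fun_mul (dχ k))
        (((dw 0 k).fun_mul (dφ 0)).fun_add ((dw 1 k).fun_mul (dφ 1))),
      pd_add k ((dw 0 k).fun_mul (dφ 0)) ((dw 1 k).fun_mul (dφ 1)),
      pd_mul k (dF0.const_mul _) (dχ k), pd_const_mul k _ dF0, pd_mul k (dw 0 k) (dφ 0),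
      pd_mul k (dw 1 k) (dφ 1), pd_mul k dm (dφ k)]
    ring
  have hwpd : ∀ j k, pd k (w j k) x = invConf a x * (-2 * logConf k x *
      (2 * c * S j k x - c ^ 2 * (pd k F x * pd j F x))
      + (2 * c * pd k (S j k) x
        - c ^ 2 * (pd k (pd k F) x * pd j F x + pd k F x * pd k (pd j F) x))) := fun j k => by
    rw [hw]
    simp only
    rw [pd_mul k dρ (((dS j k).const_mul _).fun_sub (((dF k).fun_mul (dF j)).const_mul _)),
      pd_sub k ((dS j k).const_mul _) (((dF k).fun_mul (dF j)).const_mul _),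
      pd_const_mul k _ (dS j k), pd_const_mul k _ ((dF k).fun_mul (dF j)),
      pd_mul k (dF k) (dF j), pd_invConf a k hx]
    ring
  have hmpd : ∀ k, pd k m x = 2 * c * a ^ 2 * pd k F x + c ^ 2 * invConf a x *
      (-logConf k x * N x + (pd 0 F x * pd k (pd 0 F) x + pd 1 F x * pd k (pd 1 F) x)) := fun k => by
    rw [hm]
    rw [pd_add k (dF0.const_mul _) ((dρ.fun_mul dN).const_mul _), pd_const_mul k _ dF0,
      pd_const_mul k _ (dρ.fun_mul dN), pd_mul k dρ dN, pd_invConf a k hx, hN,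
      pd_add k ((dF 0).fun_mul (dF 0)) ((dF 1).fun_mul (dF 1)), pd_mul k (dF 0) (dF 0),
      pd_mul k (dF 1) (dF 1)]
    ring
  have hd := fun j => div_covDeriv ha hF hL hx j
  have hsymm := covDeriv_dFun_symm ha hF hx 1 0
  have htr := covDeriv_dFun_trace ha hL hx
  have hl := hL x hx
  have hFs := pd_pd_comm 0 1 hF hx
  have e1 := hdφ x hx
  have e2 := hdχ x hx
  have hd0 : invConf a x * (pd 0 (S 0 0) x + pd 1 (S 0 1) x) = -a ^ 2 * pd 0 F x := by
    rw [hd 0]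
    field_simp
  have hd1 : invConf a x * (pd 0 (S 1 0) x + pd 1 (S 1 1) x) = -a ^ 2 * pd 1 F x := by
    rw [hd 1]
    field_simp
  rw [hVpd, hVpd]
  simp only [hwpd, hmpd, inner1_hyp ha hx, inner2_hyp ha hx, symPart, deform, covDerivAlong,
    sharp_hyp ha hx, covDeriv_hyp ha hx φ, Fin.sum_univ_two]
  simp only [hw, hm, hN, dFun, delta_zero_zero, delta_zero_one, delta_one_zero, delta_one_one]
  have hS10 : S 1 0 x = S 0 1 x := hsymm
  have hS11 : S 1 1 x = -S 0 0 x := htr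
  have hSe : ∀ j k, covDeriv (hypMetric a) (dFun F) x j k = S j k x := fun _ _ => rfl
  simp only [hSe, hS10, hS11]
  rw [inv_mul_eq_iff_eq_mul₀ h0]
  linear_combination invConf a x * c * F x * e2 - 2 * c * invConf a x * φ x 0 * hd0
    - 2 * c * invConf a x * φ x 1 * hd1
    + c ^ 2 * invConf a x ^ 2 * (pd 0 F x * φ x 0 + pd 1 F x * φ x 1) * hl
    - invConf a x * m x * e1
    - c ^ 2 * invConf a x ^ 2 * (pd 1 F x * φ x 0 - pd 0 F x * φ x 1) * hFs

end Weak

/-! ### Holomorphic representation and `L²` identities -/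

section Holomorphic

variable {a : ℝ} {F : ℂ → ℝ}

lemma pd_re {g : ℂ → ℂ} (hg : DifferentiableOn ℂ g disc) {x : ℂ} (hx : x ∈ disc) (i : Fin 2) :
    pd i (fun y => (g y).re) x = (coordVec i * deriv g x).re := by
  have h1 : HasFDerivAt g _ x :=
    (hg.differentiableAt (isOpen_disc.mem_nhds hx)).hasDerivAt.hasFDerivAt.restrictScalars ℝ
  have h2 := (Complex.reCLM.hasFDerivAt.comp x h1).fderiv
  have h3 : fderiv ℝ (fun y => (g y).re) x = _ := h2
  rw [pd, h3]
  simp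

lemma harmonicOnNhd_disc (hF : ContDiffOn ℝ ∞ F disc)
    (hL : ∀ x ∈ disc, pd 0 (pd 0 F) x + pd 1 (pd 1 F) x = 0) :
    InnerProductSpace.HarmonicOnNhd F disc := by
  have key : ∀ x ∈ disc, Laplacian.laplacian F x = 0 := by
    intro x hx
    have hc := hF.contDiffAt (isOpen_disc.mem_nhds hx)
    have hd : DifferentiableAt ℝ (fderiv ℝ F) x :=
      (hc.fderiv_right (m := ∞) (by simp)).differentiableAt (by simp)
    have h : ∀ v : ℂ, fderiv ℝ (fun y => fderiv ℝ F y v) x v = fderiv ℝ (fderiv ℝ F) x v v := by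
      intro v
      rw [fderiv_clm_apply hd (differentiableAt_const _)]
      simp
    rw [InnerProductSpace.laplacian_eq_iteratedFDeriv_complexPlane]
    simp only [iteratedFDeriv_two_apply]
    have h1 := hL x hx
    change fderiv ℝ (fun y => fderiv ℝ F y _) x _ + fderiv ℝ (fun y => fderiv ℝ F y _) x _ = 0 at h1
    rw [h, h] at h1
    simpa [coordVec] using h1
  intro x hx
  exact ⟨(hF.contDiffAt (isOpen_disc.mem_nhds hx)).of_le
    (WithTop.coe_le_coe.2 le_top),
    mem_of_superset (isOpen_disc.mem_nhds hx) key⟩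

lemma exists_holomorphic (hF : ContDiffOn ℝ ∞ F disc)
    (hL : ∀ x ∈ disc, pd 0 (pd 0 F) x + pd 1 (pd 1 F) x = 0) :
    ∃ h : ℂ → ℂ, DifferentiableOn ℂ h disc ∧ ∀ z ∈ disc, (h z).re = F z := by
  obtain ⟨h, h1, h2⟩ := (harmonicOnNhd_disc hF hL).exists_analyticOnNhd_ball_re_eq
  exact ⟨h, h1.differentiableOn, h2⟩

variable {h : ℂ → ℂ}

lemma pd_eq_of_re_eq (hh : DifferentiableOn ℂ h disc) (hF : ∀ z ∈ disc, (h z).re = F z)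
    {x : ℂ} (hx : x ∈ disc) : pd 0 F x = (deriv h x).re ∧ pd 1 F x = -(deriv h x).im := by
  have h1 : ∀ i, pd i F x = (coordVec i * deriv h x).re := fun i => by
    rw [← pd_re hh hx, pd_congr_disc hx fun y hy => hF y hy]
  simp [h1, coordVec]

lemma pd_pd_eq_of_re_eq (hh : DifferentiableOn ℂ h disc) (hF : ∀ z ∈ disc, (h z).re = F z)
    {x : ℂ} (hx : x ∈ disc) : pd 0 (pd 0 F) x = (deriv (deriv h) x).re ∧
      pd 1 (pd 0 F) x = -(deriv (deriv h) x).im := by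
  have h1 : ∀ i, pd i (pd 0 F) x = (coordVec i * deriv (deriv h) x).re := fun i => by
    rw [← pd_re (hh.deriv isOpen_disc) hx,
      pd_congr_disc hx fun y hy => (pd_eq_of_re_eq hh hF hy).1]
  simp [h1, coordVec]

/-- Conformal invariance of the Dirichlet integral in dimension two, together with `h' = ∂₀F - i
∂₁F`. -/
lemma l2sq1_dFun (ha : 0 < a) (hh : DifferentiableOn ℂ h disc) (hF : ∀ z ∈ disc, (h z).re = F z) :
    l2sq1 (hypMetric a) disc (dFun F) = ∫⁻ z in disc, ENNReal.ofReal (‖deriv h z‖ ^ 2) := by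
  rw [l2sq1, lintegral_vol ha]
  refine setLIntegral_congr_fun isOpen_disc.measurableSet fun x hx => ?_
  obtain ⟨h0, h1⟩ := pd_eq_of_re_eq hh hF hx
  simp only [inner1_hyp ha hx, dFun]
  rw [inv_mul_cancel_left₀ (invConf_pos ha hx).ne', h0, h1, ← Complex.normSq_eq_norm_sq,
    Complex.normSq_apply, neg_mul_neg]

/-- For harmonic functions the Dirichlet norm controls the Hessian:
`∫ |∇dF|² = a² ∫ |dF|²`. -/
lemma l2sq2_covDeriv (ha : 0 < a) (hFs : ContDiffOn ℝ ∞ F disc)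
    (hL : ∀ x ∈ disc, pd 0 (pd 0 F) x + pd 1 (pd 1 F) x = 0) :
    l2sq2 (hypMetric a) disc (covDeriv (hypMetric a) (dFun F))
      = ENNReal.ofReal (a ^ 2) * l2sq1 (hypMetric a) disc (dFun F) := by
  obtain ⟨h, hh, hF⟩ := exists_holomorphic hFs hL
  -- The factor `2` comes from the Bergman-type identity. The factor `a² / 2` is pointwise: `|∇dF|²
  -- dV = (a² / 2) |(1 - |z|²) h'' - 2 z̄ h'|² dx dy`, as the symmetric trace-free Hessian has
  -- squared length `2 (S₀₀² + S₀₁²)` in coordinates.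
  have e : ENNReal.ofReal (a ^ 2) = ENNReal.ofReal (a ^ 2 / 2) * 2 := by
    rw [← ENNReal.ofReal_ofNat 2, ← ENNReal.ofReal_mul (by positivity)]
    congr 1
    ring
  rw [l2sq1_dFun ha hh hF, e, mul_assoc, ← lintegral_disc_norm_sq_deriv_covDeriv hh,
    ← lintegral_const_mul' _ _ ENNReal.ofReal_ne_top, l2sq2, lintegral_vol ha]
  refine setLIntegral_congr_fun isOpen_disc.measurableSet fun x hx => ?_
  rw [← ENNReal.ofReal_mul (by positivity)]
  congr 1
  obtain ⟨h0, h1⟩ := pd_eq_of_re_eq hh hF hx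
  obtain ⟨h2, h3⟩ := pd_pd_eq_of_re_eq hh hF hx
  have hb := (bdf_pos hx).ne'
  have hre : ((1 - Complex.normSq x) * deriv (deriv h) x - 2 * (starRingEnd ℂ) x * deriv h x).re
      = bdf x * covDeriv (hypMetric a) (dFun F) x 0 0 := by
    rw [covDeriv_hyp ha hx]
    simp [dFun, h0, h1, h2, logConf, coord]
    field_simp
    simp [bdf]
    ring
  have him : ((1 - Complex.normSq x) * deriv (deriv h) x - 2 * (starRingEnd ℂ) x * deriv h x).im
      = -(bdf x * covDeriv (hypMetric a) (dFun F) x 0 1) := by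
    rw [covDeriv_hyp ha hx]
    simp [dFun, h0, h1, h3, logConf, coord]
    field_simp
    simp [bdf]
    ring
  rw [← Complex.normSq_eq_norm_sq, Complex.normSq_apply, hre, him, inner2_hyp ha hx,
    covDeriv_dFun_symm ha hFs hx 1 0, covDeriv_dFun_trace ha hL hx]
  have hρ := (invConf_pos ha hx).ne'
  rw [inv_mul_eq_iff_eq_mul₀ hρ, invConf]
  ring

lemma l2sq1_const_mul (g : MetricField) (D : Set ℂ) (c : ℝ) (α : OneForm) :
    l2sq1 g D (fun x j => c * α x j) = ENNReal.ofReal (c ^ 2) * l2sq1 g D α := by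
  rw [l2sq1, l2sq1, ← lintegral_const_mul' _ _ ENNReal.ofReal_ne_top]
  refine lintegral_congr fun x => ?_
  rw [← ENNReal.ofReal_mul (sq_nonneg c)]
  congr 1
  simp only [inner1, Fin.sum_univ_two]
  ring

lemma l2sq2_const_mul (g : MetricField) (D : Set ℂ) (c : ℝ) (S : TwoTensor) :
    l2sq2 g D (fun x j k => c * S x j k) = ENNReal.ofReal (c ^ 2) * l2sq2 g D S := by
  rw [l2sq2, l2sq2, ← lintegral_const_mul' _ _ ENNReal.ofReal_ne_top]
  refine lintegral_congr fun x => ?_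
  rw [← ENNReal.ofReal_mul (sq_nonneg c)]
  congr 1
  simp only [inner2, Fin.sum_univ_two]
  ring

lemma l2sq2_symPart (ha : 0 < a) {S : TwoTensor} (hS : ∀ x ∈ disc, ∀ j k, S x j k = S x k j) :
    l2sq2 (hypMetric a) disc (symPart S) = l2sq2 (hypMetric a) disc S := by
  rw [l2sq2, l2sq2, lintegral_vol ha, lintegral_vol ha]
  refine setLIntegral_congr_fun isOpen_disc.measurableSet fun x hx => ?_
  simp only [inner2_hyp ha hx, symPart, hS x hx 1 0]
  congr 1
  ring

end Holomorphic

/-! ### Leray–Hopf solutions -/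

section LerayHopf

variable {a A : ℝ} {F : ℂ → ℝ}

lemma psi_sq (A t : ℝ) : psi A t ^ 2 = Real.exp (-A * t) := by
  rw [psi, ← Real.exp_nat_mul]
  congr 1
  push_cast
  ring

lemma lintegral_psi_sq_lt_top (hA : 0 < A) :
    ∫⁻ t in Ioi (0 : ℝ), ENNReal.ofReal (psi A t ^ 2) < ⊤ := by
  simp_rw [psi_sq]
  exact (exp_neg_integrableOn_Ioi 0 hA).lintegral_lt_top

lemma lintegral_psi_sq (hA : 0 < A) {t : ℝ} (ht : 0 ≤ t) :
    ∫⁻ s in Ioc 0 t, ENNReal.ofReal (psi A s ^ 2)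
      = ENNReal.ofReal ((1 - psi A t ^ 2) / A) := by
  have hc : Continuous fun s => Real.exp (-A * s) := by fun_prop
  simp_rw [psi_sq]
  rw [← ofReal_integral_eq_lintegral_ofReal (hc.intervalIntegrable 0 t).1
    (ae_of_all _ fun s => (Real.exp_pos _).le), ← intervalIntegral.integral_of_le ht]
  congr 1
  have hd : ∀ s ∈ uIcc 0 t, HasDerivAt (fun s => -Real.exp (-A * s) / A) (Real.exp (-A * s)) s :=
    fun s _ => by
      have h1 : HasDerivAt (fun s : ℝ => -A * s) (-A) s := by
        simpa using (hasDerivAt_id s).const_mul (-A)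
      refine ((h1.exp.neg).div_const A).congr_deriv ?_
      field_simp
  rw [intervalIntegral.integral_eq_sub_of_hasDerivAt hd (hc.intervalIntegrable 0 t)]
  simp
  ring

/-- All norms reduce to multiples of `E = ∫ |dF|²`, which is finite by the `C¹` boundary condition,
so each bound becomes a statement about `ψ` alone. -/
theorem isLerayHopf_velocity (ha : 0 < a) (hA : 2 * a ^ 2 ≤ A) (h : IsHarmonicC1 a F) :
    IsLerayHopf (hypMetric a) disc (dFun F) (velocity A F) := by
  have hA0 : 0 < A := lt_of_lt_of_le (by positivity) hA
  have hF := h.smooth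
  have hL := h.laplacian_eq_zero ha
  set S : TwoTensor := covDeriv (hypMetric a) (dFun F) with hS
  set E := l2sq1 (hypMetric a) disc (dFun F) with hE
  have hEt : E < ⊤ := by
    obtain ⟨f, hf, hre⟩ := exists_holomorphic hF hL
    rw [hE, l2sq1_dFun ha hf hre]
    exact lintegral_disc_norm_sq_deriv_lt_top hf hre h.continuous h.boundary
  have hU : ∀ t, l2sq1 (hypMetric a) disc (velocity A F t) = ENNReal.ofReal (psi A t ^ 2) * E :=
    fun t => l2sq1_const_mul _ _ _ _
  have hT : ∀ t, l2sq2 (hypMetric a) disc (fun x j k => psi A t * S x j k)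
      = ENNReal.ofReal (psi A t ^ 2) * (ENNReal.ofReal (a ^ 2) * E) := fun t => by
    rw [l2sq2_const_mul, hS, l2sq2_covDeriv ha hF hL]
  have hTs : ∀ t, l2sq2 (hypMetric a) disc (symPart fun x j k => psi A t * S x j k)
      = ENNReal.ofReal (psi A t ^ 2) * (ENNReal.ofReal (a ^ 2) * E) := fun t => by
    rw [← hT]
    refine l2sq2_symPart ha fun x hx j k => ?_
    rw [hS, covDeriv_dFun_symm ha hF hx]
  have hdFc : ContinuousOn (dFun F) disc :=
    continuousOn_pi.2 fun j => (contDiffOn_pd j hF).continuousOn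
  have hSc : ContinuousOn S disc := continuousOn_pi.2 fun j => continuousOn_pi.2 fun k =>
    (contDiffOn_covDeriv ha hF j k).continuousOn
  have hpsi1 : ∀ t ≥ 0, psi A t ^ 2 ≤ 1 := fun t ht => by
    rw [psi_sq, Real.exp_le_one_iff]
    nlinarith
  have hpsic : Continuous (psi A) := (contDiff_psi A).continuous
  refine ⟨fun t x j k => psi A t * S x j k, ?_⟩
  constructor
  · exact aestronglyMeasurable_vol hdFc
  · exact hEt
  · simpa using isWeaklyDivFree_velocity ha hF hL 1
  · intro t _
    exact aestronglyMeasurable_vol (hdFc.const_smul (psi A t))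
  · exact (hpsic.comp continuous_fst).aestronglyMeasurable.smul
      (aestronglyMeasurable_vol hdFc).comp_snd
  · exact (hpsic.comp continuous_fst).aestronglyMeasurable.smul
      (aestronglyMeasurable_vol hSc).comp_snd
  · refine ae_of_all _ fun t => isWeakCovDeriv_of_smooth
      (fun j => contDiffOn_const.mul (contDiffOn_pd j hF))
      (fun j k => continuousOn_const.mul (contDiffOn_covDeriv ha hF j k).continuousOn)
      fun x hx => ?_
    funext j k
    rw [hS, covDeriv_hyp ha hx, covDeriv_hyp ha hx, pd_velocity t hF hx]
    simp only [velocity, dFun]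
    ring
  · refine ⟨E.toReal, ?_⟩
    filter_upwards [ae_restrict_mem measurableSet_Ioi] with t ht
    rw [hU, ENNReal.ofReal_toReal hEt.ne]
    exact mul_le_of_le_one_left' (ENNReal.ofReal_le_one.2 (hpsi1 t (le_of_lt ht)))
  · simp_rw [hU, hT, ← mul_add]
    rw [lintegral_mul_const _ (by fun_prop)]
    exact ENNReal.mul_lt_top (lintegral_psi_sq_lt_top hA0)
      (ENNReal.add_lt_top.2 ⟨hEt, ENNReal.mul_lt_top ENNReal.ofReal_lt_top hEt⟩)
  · exact ae_of_all _ fun t => isWeaklyDivFree_velocity ha hF hL (psi A t)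
  · intro φ hφ
    -- The spatial integral vanishes at each time separately; even the term with `∂_t φ` needs no
    -- integration by parts in time.
    have hz : ∀ t : ℝ, _ := fun t =>
      integral_momentum_slice ha hF hL (psi A t) (hφ.slice ha t).1 (hφ.slice ha t).2.1
        (hφ.slice ha t).2.2.1 (hφ.slice ha t).2.2.2
    exact (integral_congr_ae (ae_of_all _ hz)).trans (integral_zero _ _)
  · intro t ht
    simp_rw [hU, hTs]
    have h1 : 0 ≤ 1 - psi A t ^ 2 := sub_nonneg.2 (hpsi1 t ht)
    have h2 : 0 ≤ 2 * ((1 - psi A t ^ 2) / A) := by positivity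
    rw [lintegral_mul_const _ (by fun_prop), lintegral_psi_sq hA0 ht, ← ENNReal.ofReal_ofNat 2,
      ← mul_assoc, ← ENNReal.ofReal_mul zero_le_two, ← mul_assoc, ← ENNReal.ofReal_mul h2,
      ← add_mul, ← ENNReal.ofReal_add (sq_nonneg _) (by positivity)]
    refine mul_le_of_le_one_left' (ENNReal.ofReal_le_one.2 ?_)
    -- The only use of the threshold `2a² ≤ A` beyond positivity of `A`; equality in it gives
    -- equality in the energy balance.
    have h3 : 2 * ((1 - psi A t ^ 2) / A) * a ^ 2 ≤ 1 - psi A t ^ 2 := by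
      rw [show 2 * ((1 - psi A t ^ 2) / A) * a ^ 2 = (1 - psi A t ^ 2) * (2 * a ^ 2) / A by ring,
        div_le_iff₀ hA0]
      exact mul_le_mul_of_nonneg_left hA h1
    linarith
  · have h1 : ∀ t, l2sq1 (hypMetric a) disc (fun x j => velocity A F t x j - dFun F x j)
        = ENNReal.ofReal ((psi A t - 1) ^ 2) * E := fun t => by
      rw [← l2sq1_const_mul]
      congr 1
      funext x j
      rw [velocity]
      ring
    simp_rw [h1]
    have h2 : Tendsto (fun t => ENNReal.ofReal ((psi A t - 1) ^ 2)) (𝓝 0) (𝓝 0) := by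
      have : Continuous fun t => ENNReal.ofReal ((psi A t - 1) ^ 2) :=
        ENNReal.continuous_ofReal.comp ((hpsic.sub continuous_const).pow 2)
      simpa [psi] using this.tendsto 0
    simpa using (ENNReal.Tendsto.mul_const h2 (Or.inr hEt.ne)).mono_left nhdsWithin_le_nhds

lemma psi_injective {A B t : ℝ} (ht : 0 < t) (h : psi A t = psi B t) : A = B := by
  have := Real.exp_injective h
  nlinarith [mul_right_cancel₀ ht.ne' (by linarith : A * t = B * t)]

/-- The solutions with different decay rates differ at all positive times. -/
theorem velocity_not_ae_eq (ha : 0 < a) (hF : ContDiffOn ℝ ∞ F disc)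
    (hne : ∃ x ∈ disc, ∃ y ∈ disc, F x ≠ F y) {A B : ℝ} (hAB : A ≠ B) {t : ℝ} (ht : 0 < t) :
    ¬ velocity A F t =ᵐ[vol (hypMetric a) disc] velocity B F t := by
  intro hae
  obtain ⟨x, hx, y, hy, hxy⟩ := hne
  apply hxy
  have hc : psi A t - psi B t ≠ 0 := sub_ne_zero.2 fun h => hAB (psi_injective ht h)
  have h1 : dFun F =ᵐ[volume.restrict disc] fun _ _ => 0 := by
    filter_upwards [(absolutelyContinuous_vol ha).ae_le hae] with z hz
    funext j
    have h2 := congrFun hz j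
    simp only [velocity] at h2
    exact (mul_eq_zero.1 (by linear_combination h2 :
      (psi A t - psi B t) * dFun F z j = 0)).resolve_left hc
  have hdFc : ContinuousOn (dFun F) disc :=
    continuousOn_pi.2 fun j => (contDiffOn_pd j hF).continuousOn
  -- Continuity upgrades almost everywhere vanishing to vanishing on the open disc, and `F` is then
  -- constant by convexity.
  have h3 : EqOn (dFun F) (fun _ _ => 0) disc :=
    Measure.eqOn_open_of_ae_eq h1 isOpen_disc hdFc continuousOn_const
  refine (convex_ball (0 : ℂ) 1).is_const_of_fderivWithin_eq_zero (𝕜 := ℝ)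
    (hF.differentiableOn (by simp)) (fun z hz => ?_) hx hy
  rw [fderivWithin_of_isOpen Metric.isOpen_ball hz]
  ext v
  have h4 : v = v.re • coordVec 0 + v.im • coordVec 1 := by
    simp [coordVec]
  have h5 : ∀ j, fderiv ℝ F z (coordVec j) = 0 := fun j => congrFun (h3 hz) j
  rw [h4, map_add, map_smul, map_smul, h5, h5]
  simp

/-- The coordinate function `re z` is harmonic. -/
lemma isHarmonicC1_re (ha : 0 < a) : IsHarmonicC1 a Complex.re where
  smooth := Complex.reCLM.contDiff.contDiffOn
  harmonic x hx := by
    have h : ∀ i, pd i Complex.re = fun _ => delta i 0 := fun i => funext fun y => pd_coord i 0 y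
    rw [laplaceBeltrami_hyp ha hx, h, h, pd_const, pd_const]
    simp
  continuous := Complex.continuous_re.continuousOn
  boundary := by
    have : (fun θ : ℝ => (Complex.exp (θ * Complex.I)).re) = Real.cos :=
      funext Complex.exp_ofReal_mul_I_re
    rw [this]
    exact Real.contDiff_cos

lemma exists_re_ne : ∃ x ∈ disc, ∃ y ∈ disc, Complex.re x ≠ Complex.re y :=
  ⟨0, by simp [disc], 1 / 2, by simp [disc]; norm_num, by norm_num⟩

end LerayHopf

end HypNS

theorem theorem1p2 (a : ℝ) (ha : 0 < a) :
    -- non-uniqueness of Leray–Hopf solutions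
    (∃ (u₀ : HypNS.OneForm) (U V : ℝ → HypNS.OneForm),
      HypNS.IsLerayHopf (HypNS.hypMetric a) HypNS.disc u₀ U ∧
      HypNS.IsLerayHopf (HypNS.hypMetric a) HypNS.disc u₀ V ∧
      ∃ t > 0, ¬ U t =ᵐ[HypNS.vol (HypNS.hypMetric a) HypNS.disc] V t) ∧
    -- there are nonconstant harmonic functions as used below
    (∃ F : ℂ → ℝ, HypNS.IsHarmonicC1 a F ∧
      ∃ x ∈ HypNS.disc, ∃ y ∈ HypNS.disc, F x ≠ F y) ∧
    -- each of them gives a one-parameter family of distinct solutions with datum `dF`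
    ∀ F : ℂ → ℝ, HypNS.IsHarmonicC1 a F →
      (∃ x ∈ HypNS.disc, ∃ y ∈ HypNS.disc, F x ≠ F y) →
      (∀ A : ℝ, 2 * a ^ 2 ≤ A →
        HypNS.IsSmoothSolution (HypNS.hypMetric a) HypNS.disc
          (HypNS.velocity A F) (HypNS.pressure a A F) ∧
        HypNS.IsLerayHopf (HypNS.hypMetric a) HypNS.disc
          (HypNS.dFun F) (HypNS.velocity A F)) ∧
      ∀ A B : ℝ, 2 * a ^ 2 ≤ A → 2 * a ^ 2 ≤ B → A ≠ B → ∀ t > 0,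
        ¬ HypNS.velocity A F t =ᵐ[HypNS.vol (HypNS.hypMetric a) HypNS.disc]
          HypNS.velocity B F t := by
  have main : ∀ F : ℂ → ℝ, HypNS.IsHarmonicC1 a F → ∀ A : ℝ, 2 * a ^ 2 ≤ A →
      HypNS.IsLerayHopf (HypNS.hypMetric a) HypNS.disc (HypNS.dFun F) (HypNS.velocity A F) :=
    fun F hF A hA => HypNS.isLerayHopf_velocity ha hA hF
  have hre := HypNS.isHarmonicC1_re ha
  -- Any two rates at or above `2a²` would serve; the first chosen is the critical one.
  refine ⟨⟨HypNS.dFun Complex.re, HypNS.velocity (2 * a ^ 2) Complex.re,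
    HypNS.velocity (2 * a ^ 2 + 1) Complex.re, main _ hre _ le_rfl, main _ hre _ (by linarith),
    1, one_pos, HypNS.velocity_not_ae_eq ha hre.smooth HypNS.exists_re_ne (by linarith) one_pos⟩,
    ⟨Complex.re, hre, HypNS.exists_re_ne⟩, fun F hF hne => ⟨fun A hA =>
      ⟨HypNS.isSmoothSolution_velocity ha A hF.smooth (hF.laplacian_eq_zero ha), main F hF A hA⟩,
      fun A B _ _ hAB t ht => HypNS.velocity_not_ae_eq ha hF.smooth hne hAB ht⟩⟩
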